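/- Let $\mathsf{Ch}^*_\mathbb{Q}$ be the category of cochain complexes of $\mathbb{Q}$-vector spaces concentrated in degrees $\ge 0$, and $\mathsf{CGDA}_\mathbb{Q}$ the category of (unital, graded-commutative) commutative differential graded $\mathbb{Q}$-algebras concentrated in degrees $\ge 0$. Let $\Lambda : \mathsf{Ch}^*_\mathbb{Q} \to \mathsf{CGDA}_\mathbb{Q}$ be the free CDGA functor, left adjoint to the forgetful functor $U$. Let $\mathbb{R}_+=[0,\infty)$ be regarded as a poset, and write $p\mathcal{C}=\mathsf{Fun}(\mathbb{R}_+,\mathcal{C})$; post-composition gives an adjunction $\Lambda : p\mathsf{Ch}^*_\mathbb{Q} \rightleftarrows p\mathsf{CGDA}_\mathbb{Q} : U$. For $k\in\mathbb{N}$ let $S^k$ be $\mathbb{Q}$ in degree $k$, and let $D^k$ be $\mathbb{Q}\xrightarrow{=}\mathbb{Q}$ in degrees $k-1,k$, with $D^0=0$. There is a canonical map $S^k\to D^k$, which is zero for $k=0$. For $0\le s<t<\infty$ let $\mathbb{S}^k_{[s,t)}\in p\mathsf{Ch}^*_\mathbb{Q}$ be the left Kan extension of $(s<t)\mapsto(S^k\to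 D^k)$ along $\{s<t\}\subseteq\mathbb{R}_+$. Let $\mathbb{S}^k_{[s,\infty)}$ and $\mathbb{D}^k_s$ be the left Kan extensions of $s\mapsto S^k$ and $s\mapsto D^k$ along $\{s\}\subseteq\mathbb{R}_+$, and put $\mathbb{D}^k_\infty=0$. Let $$\mathbb{I}=\{\mathbb{S}^k_{[s,t)}\to\mathbb{D}^k_s \mid k\in\mathbb{N},\ 0\le s<t\le\infty\},\qquad \mathbb{J}=\{\mathbb{D}^k_t\to\mathbb{D}^k_s \mid k\in\mathbb{N},\ 0\le s<t\le\infty\}$$ consist of the canonical maps, and let $\mathbb{W}$ be the class of pointwise quasi-isomorphisms in $p\mathsf{Ch}^*_\mathbb{Q}$. (The interval-sphere model structure on $p\mathsf{Ch}^*_\mathbb{Q}$ has weak equivalences $\mathbb{W}$, generating cofibrations $\mathbb{I}$ and generating trivial cofibrations $\mathbb{J}$; its fibrations are the maps with the right lifting property against $\mathbb{J}$.) **Theorem.** There is a combinatorial model structure on $p\mathsf{CGDA}_\mathbb{Q}$ whose weak equivalences are the maps $f$ with $Uf\in\mathbb{W}$ (the pointwise quasi-isomorphisms), whose fibrations are the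 maps $f$ such that $Uf$ has the right lifting property against $\mathbb{J}$, and for which $\Lambda\mathbb{I}$ and $\Lambda\mathbb{J}$ are sets of generating cofibrations and generating trivial cofibrations. That is: $p\mathsf{CGDA}_\mathbb{Q}$ is locally presentable, complete and cocomplete; $\Lambda\mathbb{I}$ and $\Lambda\mathbb{J}$ are small sets that permit the small object argument; the trivial fibrations (resp. fibrations) are exactly the maps with the right lifting property against $\Lambda\mathbb{I}$ (resp. $\Lambda\mathbb{J}$); the cofibrations (resp. trivial cofibrations) are exactly the maps with the left lifting property against the trivial fibrations (resp. fibrations); and both factorizations can be chosen functorially. -/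

import Mathlib

open CategoryTheory CategoryTheory.Limits HomotopicalAlgebra
open scoped NNReal ZeroObject

namespace PersistentCDGA

/-- Cochain complexes of rational vector spaces, concentrated in non-negative degrees. -/
abbrev Ch : Type 1 := CochainComplex (ModuleCat.{0} ℚ) ℕ

/-- A commutative differential graded algebra over `ℚ`: a non-negatively graded cochain complex
with a unital, associative, graded-commutative multiplication satisfying the Leibniz rule.
The product of an element of degree `i` and one of degree `j` is recorded in any degree `k` with
`i + j = k`. -/
structure CDGA : Type 1 where
  /-- the underlying cochain complex -/
  cx : Ch
  /-- the unit -/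
  one : cx.X 0
  /-- the multiplication -/
  mul : ∀ {i j k : ℕ}, i + j = k → (cx.X i →ₗ[ℚ] cx.X j →ₗ[ℚ] cx.X k)
  one_mul : ∀ {i : ℕ} (x : cx.X i), mul (Nat.zero_add i) one x = x
  mul_one : ∀ {i : ℕ} (x : cx.X i), mul (Nat.add_zero i) x one = x
  mul_assoc : ∀ {i j k ij jk l : ℕ} (hij : i + j = ij) (hjk : j + k = jk)
    (h₁ : ij + k = l) (h₂ : i + jk = l) (x : cx.X i) (y : cx.X j) (z : cx.X k),
    mul h₁ (mul hij x y) z = mul h₂ x (mul hjk y z)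
  mul_comm : ∀ {i j k : ℕ} (h : i + j = k) (h' : j + i = k) (x : cx.X i) (y : cx.X j),
    mul h x y = ((-1 : ℚ) ^ (i * j)) • mul h' y x
  leibniz : ∀ {i j k : ℕ} (h : i + j = k) (h₁ : (i + 1) + j = k + 1) (h₂ : i + (j + 1) = k + 1)
    (x : cx.X i) (y : cx.X j),
    cx.d k (k + 1) (mul h x y) =
      mul h₁ (cx.d i (i + 1) x) y + ((-1 : ℚ) ^ i) • mul h₂ x (cx.d j (j + 1) y)

namespace CDGA

/-- Morphisms of CDGAs: cochain maps preserving unit and multiplication. -/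
@[ext]
structure Hom (A B : CDGA) : Type where
  /-- the underlying cochain map -/
  hom : A.cx ⟶ B.cx
  map_one : hom.f 0 A.one = B.one
  map_mul : ∀ {i j k : ℕ} (h : i + j = k) (x : A.cx.X i) (y : A.cx.X j),
    hom.f k (A.mul h x y) = B.mul h (hom.f i x) (hom.f j y)

instance : Category CDGA where
  Hom := Hom
  id A := { hom := 𝟙 _, map_one := by simp, map_mul := by simp }
  comp f g :=
    { hom := f.hom ≫ g.hom
      map_one := by simp [f.map_one, g.map_one]
      map_mul := by simp [f.map_mul, g.map_mul] }

@[ext]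
lemma hom_ext {A B : CDGA} {f g : A ⟶ B} (h : f.hom = g.hom) : f = g := Hom.ext h

@[simp] lemma id_hom (A : CDGA) : Hom.hom (𝟙 A) = 𝟙 A.cx := rfl

@[simp] lemma comp_hom {A B C : CDGA} (f : A ⟶ B) (g : B ⟶ C) :
    (f ≫ g).hom = f.hom ≫ g.hom := rfl

/-- The forgetful functor `U` from CDGAs to cochain complexes. -/
def forget : CDGA ⥤ Ch where
  obj A := A.cx
  map f := f.hom

end CDGA

/-! ### The free CDGA on a cochain complex, by generators and relations -/

/-- Formal expressions of degree `n` in the CDGA operations on generators taken from `V`. -/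
inductive FreeTerm (V : Ch) : ℕ → Type
  | of {n : ℕ} (x : V.X n) : FreeTerm V n
  | zero (n : ℕ) : FreeTerm V n
  | add {n : ℕ} (a b : FreeTerm V n) : FreeTerm V n
  | smul {n : ℕ} (q : ℚ) (a : FreeTerm V n) : FreeTerm V n
  | one : FreeTerm V 0
  | mul {i j k : ℕ} (h : i + j = k) (a : FreeTerm V i) (b : FreeTerm V j) : FreeTerm V k
  | d {n : ℕ} (a : FreeTerm V n) : FreeTerm V (n + 1)

open FreeTerm in
/-- The congruence on formal expressions generated by the CDGA axioms and by the requirement that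
`V → ΛV` be a linear cochain map. -/
inductive FreeRel (V : Ch) : ∀ {n : ℕ}, FreeTerm V n → FreeTerm V n → Prop
  | refl {n : ℕ} (a : FreeTerm V n) : FreeRel V a a
  | symm {n : ℕ} {a b : FreeTerm V n} : FreeRel V a b → FreeRel V b a
  | trans {n : ℕ} {a b c : FreeTerm V n} : FreeRel V a b → FreeRel V b c → FreeRel V a c
  | add_congr {n : ℕ} {a a' b b' : FreeTerm V n} :
      FreeRel V a a' → FreeRel V b b' → FreeRel V (add a b) (add a' b')
  | smul_congr {n : ℕ} (q : ℚ) {a a' : FreeTerm V n} :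
      FreeRel V a a' → FreeRel V (smul q a) (smul q a')
  | mul_congr {i j k : ℕ} (h : i + j = k) {a a' : FreeTerm V i} {b b' : FreeTerm V j} :
      FreeRel V a a' → FreeRel V b b' → FreeRel V (mul h a b) (mul h a' b')
  | d_congr {n : ℕ} {a a' : FreeTerm V n} : FreeRel V a a' → FreeRel V (d a) (d a')
  | add_assoc {n : ℕ} (a b c : FreeTerm V n) : FreeRel V (add (add a b) c) (add a (add b c))
  | add_comm {n : ℕ} (a b : FreeTerm V n) : FreeRel V (add a b) (add b a)
  | zero_add {n : ℕ} (a : FreeTerm V n) : FreeRel V (add (zero n) a) a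
  | zero_smul {n : ℕ} (a : FreeTerm V n) : FreeRel V (smul 0 a) (zero n)
  | one_smul {n : ℕ} (a : FreeTerm V n) : FreeRel V (smul 1 a) a
  | mul_smul {n : ℕ} (p q : ℚ) (a : FreeTerm V n) :
      FreeRel V (smul (p * q) a) (smul p (smul q a))
  | smul_add {n : ℕ} (q : ℚ) (a b : FreeTerm V n) :
      FreeRel V (smul q (add a b)) (add (smul q a) (smul q b))
  | add_smul {n : ℕ} (p q : ℚ) (a : FreeTerm V n) :
      FreeRel V (smul (p + q) a) (add (smul p a) (smul q a))
  | add_mul {i j k : ℕ} (h : i + j = k) (a a' : FreeTerm V i) (b : FreeTerm V j) :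
      FreeRel V (mul h (add a a') b) (add (mul h a b) (mul h a' b))
  | mul_add {i j k : ℕ} (h : i + j = k) (a : FreeTerm V i) (b b' : FreeTerm V j) :
      FreeRel V (mul h a (add b b')) (add (mul h a b) (mul h a b'))
  | smul_mul {i j k : ℕ} (h : i + j = k) (q : ℚ) (a : FreeTerm V i) (b : FreeTerm V j) :
      FreeRel V (mul h (smul q a) b) (smul q (mul h a b))
  | mul_smul' {i j k : ℕ} (h : i + j = k) (q : ℚ) (a : FreeTerm V i) (b : FreeTerm V j) :
      FreeRel V (mul h a (smul q b)) (smul q (mul h a b))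
  | one_mul {i : ℕ} (a : FreeTerm V i) : FreeRel V (mul (Nat.zero_add i) one a) a
  | mul_one {i : ℕ} (a : FreeTerm V i) : FreeRel V (mul (Nat.add_zero i) a one) a
  | mul_assoc {i j k ij jk l : ℕ} (hij : i + j = ij) (hjk : j + k = jk)
      (h₁ : ij + k = l) (h₂ : i + jk = l)
      (a : FreeTerm V i) (b : FreeTerm V j) (c : FreeTerm V k) :
      FreeRel V (mul h₁ (mul hij a b) c) (mul h₂ a (mul hjk b c))
  | mul_comm {i j k : ℕ} (h : i + j = k) (h' : j + i = k) (a : FreeTerm V i) (b : FreeTerm V j) :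
      FreeRel V (mul h a b) (smul ((-1 : ℚ) ^ (i * j)) (mul h' b a))
  | d_add {n : ℕ} (a b : FreeTerm V n) : FreeRel V (d (add a b)) (add (d a) (d b))
  | d_smul {n : ℕ} (q : ℚ) (a : FreeTerm V n) : FreeRel V (d (smul q a)) (smul q (d a))
  | d_d {n : ℕ} (a : FreeTerm V n) : FreeRel V (d (d a)) (zero (n + 1 + 1))
  | leibniz {i j k : ℕ} (h : i + j = k) (h₁ : (i + 1) + j = k + 1) (h₂ : i + (j + 1) = k + 1)
      (a : FreeTerm V i) (b : FreeTerm V j) :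
      FreeRel V (d (mul h a b)) (add (mul h₁ (d a) b) (smul ((-1 : ℚ) ^ i) (mul h₂ a (d b))))
  | of_add {n : ℕ} (x y : V.X n) : FreeRel V (of (x + y)) (add (of x) (of y))
  | of_smul {n : ℕ} (q : ℚ) (x : V.X n) : FreeRel V (of (q • x)) (smul q (of x))
  | of_d {n : ℕ} (x : V.X n) : FreeRel V (of (V.d n (n + 1) x)) (d (of x))

/-- The equivalence relation on formal expressions of degree `n`. -/
def freeSetoid (V : Ch) (n : ℕ) : Setoid (FreeTerm V n) :=
  ⟨FreeRel V, FreeRel.refl, FreeRel.symm, FreeRel.trans⟩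

/-- The degree `n` part of the free CDGA on `V`. -/
def FreeObj (V : Ch) (n : ℕ) : Type := Quotient (freeSetoid V n)

namespace FreeObj

variable {V : Ch}

/-- The class of a formal expression. -/
def mk {n : ℕ} (a : FreeTerm V n) : FreeObj V n := Quotient.mk (freeSetoid V n) a

lemma sound {n : ℕ} {a b : FreeTerm V n} (h : FreeRel V a b) : mk a = mk b := Quotient.sound h

lemma ind {n : ℕ} {P : FreeObj V n → Prop} (h : ∀ a, P (mk a)) (x : FreeObj V n) : P x :=
  Quotient.ind h x

instance (n : ℕ) : Zero (FreeObj V n) := ⟨mk (.zero n)⟩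

instance (n : ℕ) : Add (FreeObj V n) :=
  ⟨Quotient.map₂ FreeTerm.add fun _ _ h _ _ h' => FreeRel.add_congr h h'⟩

instance (n : ℕ) : SMul ℚ (FreeObj V n) :=
  ⟨fun q => Quotient.map (FreeTerm.smul q) fun _ _ h => FreeRel.smul_congr q h⟩

instance (n : ℕ) : Neg (FreeObj V n) := ⟨fun x => (-1 : ℚ) • x⟩

lemma mk_add {n : ℕ} (a b : FreeTerm V n) : mk (.add a b) = mk a + mk b := rfl

lemma mk_smul {n : ℕ} (q : ℚ) (a : FreeTerm V n) : mk (.smul q a) = q • mk a := rfl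

lemma mk_zero (n : ℕ) : mk (.zero n : FreeTerm V n) = 0 := rfl

protected lemma zero_add' {n : ℕ} (x : FreeObj V n) : 0 + x = x := by
  induction x using ind with | h a => exact sound (.zero_add a)

protected lemma add_comm' {n : ℕ} (x y : FreeObj V n) : x + y = y + x := by
  induction x using ind with | h a =>
  induction y using ind with | h b => exact sound (.add_comm a b)

protected lemma zero_smul' {n : ℕ} (x : FreeObj V n) : (0 : ℚ) • x = 0 := by
  induction x using ind with | h a => exact sound (.zero_smul a)

protected lemma one_smul' {n : ℕ} (x : FreeObj V n) : (1 : ℚ) • x = x := by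
  induction x using ind with | h a => exact sound (.one_smul a)

protected lemma add_smul' {n : ℕ} (p q : ℚ) (x : FreeObj V n) : (p + q) • x = p • x + q • x := by
  induction x using ind with | h a => exact sound (.add_smul p q a)

instance (n : ℕ) : AddCommGroup (FreeObj V n) where
  add_assoc x y z := by
    induction x using ind with | h a =>
    induction y using ind with | h b =>
    induction z using ind with | h c => exact sound (.add_assoc a b c)
  zero_add := FreeObj.zero_add'
  add_zero x := by rw [FreeObj.add_comm', FreeObj.zero_add']
  add_comm := FreeObj.add_comm'
  nsmul := nsmulRec
  zsmul := zsmulRec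
  neg_add_cancel x := by
    change (-1 : ℚ) • x + x = 0
    conv_lhs => rhs; rw [← FreeObj.one_smul' x]
    rw [← FreeObj.add_smul', neg_add_cancel, FreeObj.zero_smul']

protected lemma smul_add' {n : ℕ} (q : ℚ) (x y : FreeObj V n) : q • (x + y) = q • x + q • y := by
  induction x using ind with | h a =>
  induction y using ind with | h b => exact sound (.smul_add q a b)

instance (n : ℕ) : Module ℚ (FreeObj V n) where
  one_smul := FreeObj.one_smul'
  mul_smul p q x := by
    induction x using ind with | h a => exact sound (.mul_smul p q a)
  smul_add := FreeObj.smul_add'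
  smul_zero q := by
    have h := FreeObj.smul_add' q (0 : FreeObj V n) 0
    rw [add_zero] at h
    exact left_eq_add.mp h
  add_smul := FreeObj.add_smul'
  zero_smul := FreeObj.zero_smul'

/-- The multiplication of the free CDGA. -/
def mul {i j k : ℕ} (h : i + j = k) : FreeObj V i →ₗ[ℚ] FreeObj V j →ₗ[ℚ] FreeObj V k :=
  LinearMap.mk₂ ℚ
    (Quotient.map₂ (FreeTerm.mul h) fun _ _ h₁ _ _ h₂ => FreeRel.mul_congr h h₁ h₂)
    (fun x x' y => by
      induction x using ind with | h a =>
      induction x' using ind with | h a' =>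
      induction y using ind with | h b => exact sound (.add_mul h a a' b))
    (fun q x y => by
      induction x using ind with | h a =>
      induction y using ind with | h b => exact sound (.smul_mul h q a b))
    (fun x y y' => by
      induction x using ind with | h a =>
      induction y using ind with | h b =>
      induction y' using ind with | h b' => exact sound (.mul_add h a b b'))
    (fun q x y => by
      induction x using ind with | h a =>
      induction y using ind with | h b => exact sound (.mul_smul' h q a b))

lemma mk_mul {i j k : ℕ} (h : i + j = k) (a : FreeTerm V i) (b : FreeTerm V j) :
    mk (.mul h a b) = mul h (mk a) (mk b) := rfl

/-- The differential of the free CDGA. -/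
def diff (n : ℕ) : FreeObj V n →ₗ[ℚ] FreeObj V (n + 1) where
  toFun := Quotient.map FreeTerm.d fun _ _ h => FreeRel.d_congr h
  map_add' x y := by
    induction x using ind with | h a =>
    induction y using ind with | h b => exact sound (.d_add a b)
  map_smul' q x := by
    induction x using ind with | h a => exact sound (.d_smul q a)

lemma mk_d {n : ℕ} (a : FreeTerm V n) : mk (.d a) = diff n (mk a) := rfl

/-- The generators, as a linear map. -/
def of (n : ℕ) : V.X n →ₗ[ℚ] FreeObj V n where
  toFun x := mk (.of x)
  map_add' x y := sound (.of_add x y)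
  map_smul' q x := sound (.of_smul q x)

end FreeObj

/-- The underlying cochain complex of the free CDGA on `V`. -/
noncomputable def freeComplex (V : Ch) : Ch :=
  CochainComplex.of (fun n => ModuleCat.of ℚ (FreeObj V n))
    (fun n => ModuleCat.ofHom (FreeObj.diff n)) (fun n => by
      ext x
      induction x using FreeObj.ind with | h a => exact FreeObj.sound (.d_d a))

lemma freeComplex_d (V : Ch) (n : ℕ) :
    (freeComplex V).d n (n + 1) = ModuleCat.ofHom (FreeObj.diff n) := by
  simp only [freeComplex, CochainComplex.of_d]

lemma freeComplex_d_apply (V : Ch) (n : ℕ) (x : FreeObj V n) :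
    (freeComplex V).d n (n + 1) x = FreeObj.diff n x := by
  rw [freeComplex_d]; rfl

/-- The free CDGA `ΛV` on a cochain complex `V`. -/
noncomputable def freeCDGA (V : Ch) : CDGA where
  cx := freeComplex V
  one := FreeObj.mk .one
  mul h := FreeObj.mul h
  one_mul x := by
    induction x using FreeObj.ind with | h a => exact FreeObj.sound (.one_mul a)
  mul_one x := by
    induction x using FreeObj.ind with | h a => exact FreeObj.sound (.mul_one a)
  mul_assoc hij hjk h₁ h₂ x y z := by
    induction x using FreeObj.ind with | h a =>
    induction y using FreeObj.ind with | h b =>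
    induction z using FreeObj.ind with | h c =>
      exact FreeObj.sound (.mul_assoc hij hjk h₁ h₂ a b c)
  mul_comm h h' x y := by
    induction x using FreeObj.ind with | h a =>
    induction y using FreeObj.ind with | h b => exact FreeObj.sound (.mul_comm h h' a b)
  leibniz h h₁ h₂ x y := by
    induction x using FreeObj.ind with | h a =>
    induction y using FreeObj.ind with | h b =>
    erw [freeComplex_d_apply, freeComplex_d_apply, freeComplex_d_apply]
    exact FreeObj.sound (.leibniz h h₁ h₂ a b)

/-- The inclusion of generators `V → UΛV`. -/
noncomputable def freeUnit (V : Ch) : V ⟶ (freeCDGA V).cx where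
  f n := ModuleCat.ofHom (FreeObj.of n)
  comm' := by
    rintro i j rfl
    ext x
    change (freeComplex V).d i (i + 1) (FreeObj.of i x) = FreeObj.of (i + 1) (V.d i (i + 1) x)
    erw [freeComplex_d_apply]
    exact (FreeObj.sound (.of_d x)).symm

section lift

variable {V : Ch} {A : CDGA} (φ : V ⟶ A.cx)

/-- Evaluation of formal expressions in a CDGA `A`, given a cochain map `V → UA`. -/
noncomputable def interp : ∀ {n : ℕ}, FreeTerm V n → A.cx.X n
  | _, .of x => φ.f _ x
  | _, .zero _ => 0
  | _, .add a b => interp a + interp b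
  | _, .smul q a => q • interp a
  | _, .one => A.one
  | _, .mul h a b => A.mul h (interp a) (interp b)
  | _, .d a => A.cx.d _ _ (interp a)

lemma interp_rel {n : ℕ} {a b : FreeTerm V n} (h : FreeRel V a b) :
    interp φ a = interp φ b := by
  induction h with
  | refl => rfl
  | symm _ ih => exact ih.symm
  | trans _ _ ih ih' => exact ih.trans ih'
  | add_congr _ _ ih ih' => simp only [interp, ih, ih']
  | smul_congr _ _ ih => simp only [interp, ih]
  | mul_congr _ _ _ ih ih' => simp only [interp, ih, ih']
  | d_congr _ ih => simp only [interp, ih]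
  | add_assoc => simp only [interp, add_assoc]
  | add_comm => simp only [interp]; exact add_comm _ _
  | zero_add => simp only [interp, zero_add]
  | zero_smul => simp only [interp, zero_smul]
  | one_smul => simp only [interp, one_smul]
  | mul_smul => simp only [interp, mul_smul]
  | smul_add => simp only [interp, smul_add]
  | add_smul => simp only [interp, add_smul]
  | add_mul => simp only [interp, map_add, LinearMap.add_apply]
  | mul_add => simp only [interp, map_add]
  | smul_mul => simp only [interp, map_smul, LinearMap.smul_apply]
  | mul_smul' => simp only [interp, map_smul]
  | one_mul => simp only [interp, A.one_mul]
  | mul_one => simp only [interp, A.mul_one]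
  | mul_assoc hij hjk h₁ h₂ => simp only [interp]; exact A.mul_assoc hij hjk h₁ h₂ _ _ _
  | mul_comm h h' => simp only [interp]; exact A.mul_comm h h' _ _
  | d_add => simp only [interp, map_add]
  | d_smul => simp only [interp, map_smul]
  | d_d =>
    simp only [interp]
    rw [← ModuleCat.comp_apply, HomologicalComplex.d_comp_d]
    rfl
  | leibniz h h₁ h₂ => simp only [interp]; exact A.leibniz h h₁ h₂ _ _
  | of_add => simp only [interp, map_add]
  | of_smul => simp only [interp, map_smul]
  | of_d x =>
    simp only [interp]
    rw [← ModuleCat.comp_apply, ← ModuleCat.comp_apply, HomologicalComplex.Hom.comm]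

/-- The linear map in degree `n` underlying the extension of `φ : V → UA` to `ΛV`. -/
noncomputable def liftLinear (n : ℕ) : FreeObj V n →ₗ[ℚ] A.cx.X n where
  toFun := Quotient.lift (interp φ) fun _ _ h => interp_rel φ h
  map_add' x y := by
    induction x using FreeObj.ind with | h a =>
    induction y using FreeObj.ind with | h b => rfl
  map_smul' q x := by
    induction x using FreeObj.ind with | h a => rfl

lemma liftLinear_mk {n : ℕ} (a : FreeTerm V n) :
    liftLinear φ n (FreeObj.mk a) = interp φ a := rfl

/-- The extension of a cochain map `V → UA` to a CDGA morphism `ΛV → A`. -/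
noncomputable def freeLift : freeCDGA V ⟶ A where
  hom :=
    { f := fun n => ModuleCat.ofHom (liftLinear φ n)
      comm' := by
        rintro i j rfl
        ext x
        induction x using FreeObj.ind with | h a =>
        change A.cx.d i (i + 1) (liftLinear φ i (FreeObj.mk a)) =
          liftLinear φ (i + 1) ((freeComplex V).d i (i + 1) (FreeObj.mk a))
        erw [freeComplex_d_apply]
        rfl }
  map_one := rfl
  map_mul h x y := by
    induction x using FreeObj.ind with | h a =>
    induction y using FreeObj.ind with | h b => rfl

lemma freeUnit_freeLift : freeUnit V ≫ (freeLift φ).hom = φ := by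
  ext n x
  rfl

lemma freeLift_unique (g : freeCDGA V ⟶ A) : freeLift (freeUnit V ≫ g.hom) = g := by
  have key : ∀ {n : ℕ} (a : FreeTerm V n),
      interp (freeUnit V ≫ g.hom) a = g.hom.f n (FreeObj.mk a) := by
    intro n a
    induction a with
    | of x => rfl
    | zero n => exact (map_zero (g.hom.f n).hom).symm
    | add a b iha ihb =>
      simp only [interp, iha, ihb]
      exact (map_add (g.hom.f _).hom (FreeObj.mk a) (FreeObj.mk b)).symm
    | smul q a iha =>
      simp only [interp, iha]
      exact (map_smul (g.hom.f _).hom q (FreeObj.mk a)).symm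
    | one => exact g.map_one.symm
    | mul h a b iha ihb =>
      simp only [interp, iha, ihb]
      exact (g.map_mul h (FreeObj.mk a) (FreeObj.mk b)).symm
    | @d m a iha =>
      simp only [interp, iha]
      have h := ConcreteCategory.congr_hom (g.hom.comm m (m + 1)) (FreeObj.mk a)
      refine h.trans ?_
      change g.hom.f _ ((freeComplex V).d _ _ (FreeObj.mk a)) = _
      erw [freeComplex_d_apply]
      rfl
  ext n x
  induction x using FreeObj.ind with | h a => exact key a

end lift

/-- The universal property of the free CDGA. -/
noncomputable def freeHomEquiv (V : Ch) (A : CDGA) :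
    (freeCDGA V ⟶ A) ≃ (V ⟶ CDGA.forget.obj A) where
  toFun g := freeUnit V ≫ g.hom
  invFun φ := freeLift φ
  left_inv g := freeLift_unique g
  right_inv φ := freeUnit_freeLift φ

lemma freeHomEquiv_comp (V : Ch) (A B : CDGA) (h : A ⟶ B) (g : freeCDGA V ⟶ A) :
    freeHomEquiv V B (g ≫ h) = freeHomEquiv V A g ≫ CDGA.forget.map h :=
  (Category.assoc (freeUnit V) g.hom h.hom).symm

/-- The free CDGA functor `Λ`. -/
noncomputable def free : Ch ⥤ CDGA :=
  Adjunction.leftAdjointOfEquiv (G := CDGA.forget) (F_obj := freeCDGA) freeHomEquiv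
    freeHomEquiv_comp

/-- The free-forgetful adjunction `Λ ⊣ U`. -/
noncomputable def freeAdj : free ⊣ CDGA.forget :=
  Adjunction.adjunctionOfEquivLeft (G := CDGA.forget) (F_obj := freeCDGA) freeHomEquiv
    freeHomEquiv_comp

/-! ### Persistent objects -/

/-- Persistent cochain complexes. -/
abbrev PCh : Type 1 := ℝ≥0 ⥤ Ch

/-- Persistent CDGAs. -/
abbrev PCDGA : Type 1 := ℝ≥0 ⥤ CDGA

/-- The forgetful functor from persistent CDGAs to persistent cochain complexes. -/
abbrev pForget : PCDGA ⥤ PCh := (Functor.whiskeringRight ℝ≥0 CDGA Ch).obj CDGA.forget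

/-- The free functor `Λ` from persistent cochain complexes to persistent CDGAs. -/
noncomputable abbrev pFree : PCh ⥤ PCDGA := (Functor.whiskeringRight ℝ≥0 Ch CDGA).obj free

/-- The free-forgetful adjunction on persistent objects. -/
noncomputable def pFreeAdj : pFree ⊣ pForget := freeAdj.whiskerRight ℝ≥0

/-- Pointwise quasi-isomorphisms of persistent cochain complexes. -/
def pointwiseQuasiIso : MorphismProperty PCh := fun _ _ f => ∀ i : ℝ≥0, QuasiIso (f.app i)

/-! ### Spheres, disks, interval spheres and persistent disks -/

/-- The sphere `S^k`: a copy of `ℚ` in degree `k`. -/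
noncomputable def sphere (k : ℕ) : Ch :=
  (HomologicalComplex.single (ModuleCat.{0} ℚ) (ComplexShape.up ℕ) k).obj (ModuleCat.of ℚ ℚ)

lemma rel_succ (k : ℕ) : (ComplexShape.up ℕ).Rel k (k + 1) := by simp

/-- The disk `D^k`: for `k > 0` the complex `ℚ = ℚ` in degrees `k - 1` and `k`; and `D^0 = 0`. -/
noncomputable def disk : ℕ → Ch
  | 0 => 0
  | k + 1 => HomologicalComplex.double (𝟙 (ModuleCat.of ℚ ℚ)) (rel_succ k)

/-- The canonical map `S^k → D^k`: the identity of `ℚ` in degree `k` if `k > 0`, and zero if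
`k = 0`. -/
noncomputable def sphereToDisk : ∀ k : ℕ, sphere k ⟶ disk k
  | 0 => 0
  | k + 1 => HomologicalComplex.mkHomFromSingle
      (HomologicalComplex.doubleXIso₁ (𝟙 (ModuleCat.of ℚ ℚ)) (rel_succ k)
        (Nat.succ_ne_self k).symm).inv
      (fun j _ => by
        have h := HomologicalComplex.double_d_eq_zero₀ (𝟙 (ModuleCat.of ℚ ℚ)) (rel_succ k)
          (k + 1) j (Nat.succ_ne_self k)
        exact (congrArg _ h).trans comp_zero)

/-- The left Kan extension of `{s} → Ch, s ↦ C` along the inclusion `{s} → ℝ≥0`. -/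
noncomputable def bornAt (s : ℝ≥0) (C : Ch) : PCh :=
  (Functor.fromPUnit.{0} s).leftKanExtension (Functor.fromPUnit.{0} C)

instance (s : ℝ≥0) (C : Ch) : (bornAt s C).IsLeftKanExtension
    ((Functor.fromPUnit.{0} s).leftKanExtensionUnit (Functor.fromPUnit.{0} C)) :=
  inferInstanceAs (((Functor.fromPUnit.{0} s).leftKanExtension
    (Functor.fromPUnit.{0} C)).IsLeftKanExtension _)

/-- The canonical map from `C` to the value at time `s` of its Kan extension. -/
noncomputable def bornAtUnit (s : ℝ≥0) (C : Ch) : C ⟶ (bornAt s C).obj s :=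
  ((Functor.fromPUnit.{0} s).leftKanExtensionUnit (Functor.fromPUnit.{0} C)).app ⟨⟨⟩⟩

/-- The map out of `bornAt s C` determined by its value on `C` at time `s`. -/
noncomputable def bornAtDesc {s : ℝ≥0} {C : Ch} {X : PCh} (f : C ⟶ X.obj s) : bornAt s C ⟶ X :=
  (bornAt s C).descOfIsLeftKanExtension
    ((Functor.fromPUnit.{0} s).leftKanExtensionUnit (Functor.fromPUnit.{0} C)) X
    (Discrete.natTrans fun _ => f)

/-- The persistent disk `𝔻^k_s`. -/
noncomputable abbrev pDisk (s : ℝ≥0) (k : ℕ) : PCh := bornAt s (disk k)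

/-- The interval sphere `𝕊^k_{[s,∞)}`. -/
noncomputable abbrev pSphereInf (s : ℝ≥0) (k : ℕ) : PCh := bornAt s (sphere k)

/-- The interval sphere `𝕊^k_{[s,t)}` with `s < t < ∞`: the left Kan extension of
`{s < t} → Ch`, `(s < t) ↦ (S^k → D^k)`, along the inclusion `{s < t} → ℝ≥0`. -/
noncomputable def pSphere {s t : ℝ≥0} (h : s < t) (k : ℕ) : PCh :=
  (ComposableArrows.mk₁ (homOfLE h.le)).leftKanExtension (ComposableArrows.mk₁ (sphereToDisk k))

instance {s t : ℝ≥0} (h : s < t) (k : ℕ) : (pSphere h k).IsLeftKanExtension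
    ((ComposableArrows.mk₁ (homOfLE h.le)).leftKanExtensionUnit
      (ComposableArrows.mk₁ (sphereToDisk k))) :=
  inferInstanceAs (((ComposableArrows.mk₁ (homOfLE h.le)).leftKanExtension
    (ComposableArrows.mk₁ (sphereToDisk k))).IsLeftKanExtension _)

/-- The canonical map `𝔻^k_t → 𝔻^k_s`. -/
noncomputable def pDiskToDisk {s t : ℝ≥0} (h : s < t) (k : ℕ) : pDisk t k ⟶ pDisk s k :=
  bornAtDesc (bornAtUnit s (disk k) ≫ (pDisk s k).map (homOfLE h.le))

/-- The canonical map `𝕊^k_{[s,∞)} → 𝔻^k_s`. -/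
noncomputable def pSphereInfToDisk (s : ℝ≥0) (k : ℕ) : pSphereInf s k ⟶ pDisk s k :=
  bornAtDesc (sphereToDisk k ≫ bornAtUnit s (disk k))

/-- The canonical map `𝕊^k_{[s,t)} → 𝔻^k_s`: it is induced by `S^k → D^k` at time `s` and by the
identity of `D^k` at time `t`. -/
noncomputable def pSphereToDisk {s t : ℝ≥0} (h : s < t) (k : ℕ) : pSphere h k ⟶ pDisk s k :=
  (pSphere h k).descOfIsLeftKanExtension
    ((ComposableArrows.mk₁ (homOfLE h.le)).leftKanExtensionUnit
      (ComposableArrows.mk₁ (sphereToDisk k))) (pDisk s k)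
    (ComposableArrows.homMk₁
      (F := ComposableArrows.mk₁ (sphereToDisk k))
      (G := ComposableArrows.mk₁ (homOfLE h.le) ⋙ pDisk s k)
      (sphereToDisk k ≫ bornAtUnit s (disk k))
      (bornAtUnit s (disk k) ≫ (pDisk s k).map (homOfLE h.le))
      (by
        change sphereToDisk k ≫ bornAtUnit s (disk k) ≫ (pDisk s k).map (homOfLE h.le) =
          (sphereToDisk k ≫ bornAtUnit s (disk k)) ≫ (pDisk s k).map (homOfLE h.le)
        rw [Category.assoc]))

/-- The set `𝕀` of maps `𝕊^k_{[s,t)} → 𝔻^k_s`, for `k : ℕ` and `0 ≤ s < t ≤ ∞`. -/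
inductive setI : MorphismProperty PCh
  | fin (k : ℕ) {s t : ℝ≥0} (h : s < t) : setI (pSphereToDisk h k)
  | inf (k : ℕ) (s : ℝ≥0) : setI (pSphereInfToDisk s k)

/-- The set `𝕁` of maps `𝔻^k_t → 𝔻^k_s`, for `k : ℕ` and `0 ≤ s < t ≤ ∞`, where `𝔻^k_∞ = 0`. -/
inductive setJ : MorphismProperty PCh
  | fin (k : ℕ) {s t : ℝ≥0} (h : s < t) : setJ (pDiskToDisk h k)
  | inf (k : ℕ) (s : ℝ≥0) : setJ (0 : (0 : PCh) ⟶ pDisk s k)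

/-- The set `Λ𝕀` of maps of persistent CDGAs. -/
def setΛI : MorphismProperty PCDGA := setI.strictMap pFree

/-- The set `Λ𝕁` of maps of persistent CDGAs. -/
def setΛJ : MorphismProperty PCDGA := setJ.strictMap pFree

/-- A model structure on `C` is combinatorial with generating cofibrations `I` and generating
trivial cofibrations `J`: the category `C` is locally presentable (and complete and cocomplete),
`I` and `J` are small and permit the small object argument, the trivial fibrations
(resp. fibrations) are the maps with the right lifting property against `I` (resp. `J`), the
cofibrations (resp. trivial cofibrations) are the maps with the left lifting property against
these, and the factorizations can be chosen functorially. -/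
structure IsCombinatorialModelStructure.{v, u} {C : Type u} [Category.{v} C] [ModelCategory C]
    (I J : MorphismProperty C) : Prop where
  locallyPresentable : IsLocallyPresentable.{v} C
  hasLimits : HasLimitsOfSize.{v, v} C
  hasColimits : HasColimitsOfSize.{v, v} C
  smallObjectArgument_I : MorphismProperty.HasSmallObjectArgument.{v} I
  smallObjectArgument_J : MorphismProperty.HasSmallObjectArgument.{v} J
  trivialFibrations_eq : trivialFibrations C = I.rlp
  fibrations_eq : fibrations C = J.rlp
  cofibrations_eq : cofibrations C = I.rlp.llp
  trivialCofibrations_eq : trivialCofibrations C = J.rlp.llp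
  functorialFactorization :
    MorphismProperty.HasFunctorialFactorization (cofibrations C) (trivialFibrations C)
  functorialFactorization' :
    MorphismProperty.HasFunctorialFactorization (trivialCofibrations C) (fibrations C)

end PersistentCDGA

/-! The model structure is transferred along `Λ ⊣ U`. By the recognition theorem
`exists_modelCategory`, three things suffice: a locally presentable, bicomplete category in which
`Λ𝕀` and `Λ𝕁` are small; the equality of the maps with the right lifting property against `Λ𝕀` with
those that have it against `Λ𝕁` and are weak equivalences; and the acyclicity condition, that maps
with the left lifting property against all fibrations are weak equivalences. The rest is formal: the
small object argument and a retract argument (`llp_inf_eq`).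

Presentability. Limits of CDGAs are formed on underlying complexes. Colimits are quotients of the
free CDGA on the colimit of the underlying complexes. Filtered colimits are again computed on
complexes, so the objects `Λ𝔻^{k+1}_s`, which corepresent "elements of degree `k` at time `s`", are
finitely presentable. They form a strong generator.

Trivial fibrations. Adjunction reduces the claim to persistent complexes (`setI_rlp_iff_setJ_rlp`).
There, maps out of disks and interval spheres are elements and cocycles with a primitive at a later
time. Both lifting properties thus become statements about elements, which are compared by a diagram
chase using the acyclicity of the kernel of a surjective quasi-isomorphism.

Acyclicity (`setΛJ_rlp_llp_le`). No analysis of pushouts of cells is needed. Evaluation at time `r`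
has a right adjoint, right Kan extension from the point `r`, which sends surjections of CDGAs to
fibrations. So if `j` lifts against all fibrations, each `j_r : A → B` lifts against all surjections
of CDGAs. Lifting against `A → 0` gives a retraction `ρ`. Lifting against the endpoint map `B[t, dt]
→ B × B` of polynomial forms on the interval gives a homotopy between the identity and `j_r ∘ ρ`.
Integration over `[0, 1]`, which divides by integers and so uses characteristic zero, shows that
homotopic maps agree on cohomology. -/

namespace PersistentCDGA

/-! ### Quasi-isomorphisms in terms of cocycles and coboundaries -/

section Cohomology

/-- A coboundary of a cochain complex. -/
def IsBdry (K : Ch) {n : ℕ} (y : K.X n) : Prop := ∃ (m : ℕ) (x : K.X m), K.d m n x = y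

lemma d_apply_d_apply (K : Ch) {l m n : ℕ} (x : K.X l) : K.d m n (K.d l m x) = 0 := by
  rw [← ModuleCat.comp_apply, HomologicalComplex.d_comp_d]
  rfl

lemma hom_comm_apply {K L : Ch} (f : K ⟶ L) (m n : ℕ) (x : K.X m) :
    f.f n (K.d m n x) = L.d m n (f.f m x) := by
  rw [← ModuleCat.comp_apply, ← ModuleCat.comp_apply, HomologicalComplex.Hom.comm]

/-- In `IsBdry` the degree of the primitive is left free, so that degree `0` needs no separate
treatment in general arguments. This lemma and the next recover the usual meaning in each degree. -/
lemma isBdry_zero_iff (K : Ch) (y : K.X 0) : IsBdry K y ↔ y = 0 := by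
  constructor
  · rintro ⟨m, x, rfl⟩
    rw [K.shape m 0 (by simp)]
    rfl
  · rintro rfl
    exact ⟨0, 0, map_zero _⟩

lemma isBdry_succ_iff (K : Ch) {n : ℕ} (y : K.X (n + 1)) :
    IsBdry K y ↔ ∃ x : K.X n, K.d n (n + 1) x = y := by
  constructor
  · rintro ⟨m, x, rfl⟩
    by_cases h : m = n
    · subst h
      exact ⟨x, rfl⟩
    · refine ⟨0, ?_⟩
      rw [K.shape m (n + 1) (by simpa using h), map_zero]
      rfl
  · rintro ⟨x, rfl⟩
    exact ⟨n, x, rfl⟩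

lemma IsBdry.map {K L : Ch} (f : K ⟶ L) {n : ℕ} {y : K.X n} (h : IsBdry K y) :
    IsBdry L (f.f n y) := by
  obtain ⟨m, x, rfl⟩ := h
  exact ⟨m, f.f m x, (hom_comm_apply f m n x).symm⟩

/-- `K.cycles n` is a kernel of the differential; exactness in modules turns this into a statement
about elements. -/
lemma exists_cycles (K : Ch) {n : ℕ} (x : K.X n) (hx : K.d n (n + 1) x = 0) :
    ∃ z : K.cycles n, K.iCycles n z = x := by
  have h : (ShortComplex.mk (K.iCycles n) (K.d n (n + 1)) (by simp)).Exact :=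
    ShortComplex.exact_of_f_is_kernel _ (K.cyclesIsKernel n (n + 1) (by simp))
  exact (ShortComplex.moduleCat_exact_iff _).1 h x hx

lemma iCycles_injective (K : Ch) (n : ℕ) : Function.Injective (K.iCycles n) :=
  (ModuleCat.mono_iff_injective _).1 inferInstance

lemma d_iCycles (K : Ch) (n : ℕ) (z : K.cycles n) : K.d n (n + 1) (K.iCycles n z) = 0 := by
  rw [← ModuleCat.comp_apply, HomologicalComplex.iCycles_d]
  rfl

lemma homologyπ_surjective (K : Ch) (n : ℕ) : Function.Surjective (K.homologyπ n) :=
  (ModuleCat.epi_iff_surjective _).1 inferInstance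

/-- Homology is the cokernel of `toCycles`, so its kernel consists of the images of cochains. -/
lemma homologyπ_eq_zero_iff (K : Ch) (n : ℕ) (z : K.cycles n) :
    K.homologyπ n z = 0 ↔ IsBdry K (K.iCycles n z) := by
  have h (m : ℕ) (hm : (ComplexShape.up ℕ).prev n = m) :
      (ShortComplex.mk (K.toCycles m n) (K.homologyπ n) (by simp)).Exact :=
    ShortComplex.exact_of_g_is_cokernel _ (K.homologyIsCokernel m n hm)
  constructor
  · intro hz
    obtain ⟨x, hx⟩ := (ShortComplex.moduleCat_exact_iff _).1 (h _ rfl) z hz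
    refine ⟨_, x, ?_⟩
    rw [← hx]
    change _ = (K.toCycles _ n ≫ K.iCycles n) x
    rw [HomologicalComplex.toCycles_i]
  · rintro ⟨m, x, hx⟩
    have hz : z = K.toCycles m n x := by
      apply iCycles_injective
      rw [← hx]
      change _ = (K.toCycles _ n ≫ K.iCycles n) x
      rw [HomologicalComplex.toCycles_i]
    rw [hz, ← ModuleCat.comp_apply, HomologicalComplex.toCycles_comp_homologyπ]
    rfl

lemma homologyMap_homologyπ {K L : Ch} (f : K ⟶ L) (n : ℕ) (z : K.cycles n) :
    HomologicalComplex.homologyMap f n (K.homologyπ n z) =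
      L.homologyπ n (HomologicalComplex.cyclesMap f n z) := by
  rw [← ModuleCat.comp_apply, ← ModuleCat.comp_apply, HomologicalComplex.homologyπ_naturality]

lemma iCycles_cyclesMap {K L : Ch} (f : K ⟶ L) (n : ℕ) (z : K.cycles n) :
    L.iCycles n (HomologicalComplex.cyclesMap f n z) = f.f n (K.iCycles n z) := by
  rw [← ModuleCat.comp_apply, ← ModuleCat.comp_apply, HomologicalComplex.cyclesMap_i]

/-- A cochain map is a quasi-isomorphism iff it is injective and surjective on cohomology classes,
expressed in terms of cocycles. -/
lemma quasiIso_iff_cocycles {K L : Ch} (f : K ⟶ L) :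
    QuasiIso f ↔ ∀ n : ℕ,
      (∀ x : K.X n, K.d n (n + 1) x = 0 → IsBdry L (f.f n x) → IsBdry K x) ∧
      (∀ y : L.X n, L.d n (n + 1) y = 0 →
        ∃ x : K.X n, K.d n (n + 1) x = 0 ∧ IsBdry L (y - f.f n x)) := by
  rw [quasiIso_iff]
  refine forall_congr' fun n => ?_
  rw [quasiIsoAt_iff_isIso_homologyMap, ConcreteCategory.isIso_iff_bijective]
  refine and_congr ?_ ?_
  · rw [injective_iff_map_eq_zero]
    constructor
    · intro h x hx hb
      obtain ⟨z, rfl⟩ := exists_cycles K x hx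
      rw [← homologyπ_eq_zero_iff]
      apply h
      rw [homologyMap_homologyπ, homologyπ_eq_zero_iff, iCycles_cyclesMap]
      exact hb
    · intro h c hc
      obtain ⟨z, rfl⟩ := homologyπ_surjective K n c
      rw [homologyMap_homologyπ, homologyπ_eq_zero_iff, iCycles_cyclesMap] at hc
      exact (homologyπ_eq_zero_iff _ _ _).2 (h _ (d_iCycles _ _ _) hc)
  · constructor
    · intro h y hy
      obtain ⟨z, rfl⟩ := exists_cycles L y hy
      obtain ⟨c, hc⟩ := h (L.homologyπ n z)
      obtain ⟨w, rfl⟩ := homologyπ_surjective K n c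
      refine ⟨K.iCycles n w, d_iCycles _ _ _, ?_⟩
      rw [← iCycles_cyclesMap, ← map_sub, ← homologyπ_eq_zero_iff, map_sub,
        ← homologyMap_homologyπ, hc, sub_self]
    · intro h c
      obtain ⟨z, rfl⟩ := homologyπ_surjective L n c
      obtain ⟨x, hx, hb⟩ := h _ (d_iCycles _ _ z)
      obtain ⟨w, rfl⟩ := exists_cycles K x hx
      refine ⟨K.homologyπ n w, ?_⟩
      rw [← iCycles_cyclesMap, ← map_sub, ← homologyπ_eq_zero_iff, map_sub,
        ← homologyMap_homologyπ, sub_eq_zero] at hb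
      exact hb.symm

end Cohomology

/-! ### Maps out of disks and spheres -/

section Generators

/-- The degree `k` generator of the disk `D^{k+1}`. -/
noncomputable def diskGen (k : ℕ) : (disk (k + 1)).X k :=
  (HomologicalComplex.doubleXIso₀ (𝟙 (ModuleCat.of ℚ ℚ)) (rel_succ k)).inv (1 : ℚ)

/-- The generator of the sphere `S^k`. -/
noncomputable def sphereGen (k : ℕ) : (sphere k).X k :=
  (HomologicalComplex.singleObjXSelf (ComplexShape.up ℕ) k (ModuleCat.of ℚ ℚ)).inv (1 : ℚ)

lemma rat_hom_ext {M : ModuleCat.{0} ℚ} {f g : ModuleCat.of ℚ ℚ ⟶ M}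
    (h : f (1 : ℚ) = g (1 : ℚ)) : f = g := by
  ext
  exact h

/-- The linear map `ℚ → M` sending `1` to `x`. -/
noncomputable def ratHom {M : ModuleCat.{0} ℚ} (x : M) : ModuleCat.of ℚ ℚ ⟶ M :=
  ModuleCat.ofHom (LinearMap.toSpanSingleton ℚ M x)

lemma ratHom_one {M : ModuleCat.{0} ℚ} (x : M) : ratHom x (1 : ℚ) = x := by
  change (1 : ℚ) • x = x
  rw [one_smul]

/-- The double complex on an identity corepresents the degree `k` part, and a linear map from `ℚ` is
determined at `1`. -/
lemma disk_hom_ext {k : ℕ} {K : Ch} {φ ψ : disk (k + 1) ⟶ K}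
    (h : φ.f k (diskGen k) = ψ.f k (diskGen k)) : φ = ψ := by
  apply (HomologicalComplex.evalCompCoyonedaCorepresentableByDoubleId (rel_succ k)
    (Nat.succ_ne_self k).symm (ModuleCat.of ℚ ℚ)).homEquiv.injective
  exact rat_hom_ext h

/-- The map out of `D^{k+1}` determined by the image of the generator. -/
noncomputable def diskHom {k : ℕ} {K : Ch} (x : K.X k) : disk (k + 1) ⟶ K :=
  (HomologicalComplex.evalCompCoyonedaCorepresentableByDoubleId (rel_succ k)
    (Nat.succ_ne_self k).symm (ModuleCat.of ℚ ℚ)).homEquiv.symm (ratHom x)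

@[simp]
lemma diskHom_diskGen {k : ℕ} {K : Ch} (x : K.X k) : (diskHom x).f k (diskGen k) = x := by
  have h := (HomologicalComplex.evalCompCoyonedaCorepresentableByDoubleId (rel_succ k)
    (Nat.succ_ne_self k).symm (ModuleCat.of ℚ ℚ)).homEquiv.apply_symm_apply (ratHom x)
  exact (ConcreteCategory.congr_hom h (1 : ℚ)).trans (ratHom_one x)

lemma diskHom_eta {k : ℕ} {K : Ch} (φ : disk (k + 1) ⟶ K) :
    diskHom (φ.f k (diskGen k)) = φ :=
  disk_hom_ext (diskHom_diskGen _)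

lemma disk_zero_hom_ext {K : Ch} (φ ψ : disk 0 ⟶ K) : φ = ψ :=
  (isZero_zero Ch).eq_of_src φ ψ

lemma d_sphereGen (k l : ℕ) : (sphere k).d k l (sphereGen k) = 0 := by
  have h : (sphere k).d k l = 0 := HomologicalComplex.single_obj_d _ _ _ _ _
  rw [h]
  rfl

lemma sphere_hom_ext {k : ℕ} {K : Ch} {φ ψ : sphere k ⟶ K}
    (h : φ.f k (sphereGen k) = ψ.f k (sphereGen k)) : φ = ψ := by
  apply HomologicalComplex.from_single_hom_ext
  rw [← cancel_epi (HomologicalComplex.singleObjXSelf (ComplexShape.up ℕ) k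
    (ModuleCat.of ℚ ℚ)).inv]
  exact rat_hom_ext h

/-- The map out of `S^k` determined by a cocycle of degree `k`. -/
noncomputable def sphereHom {k : ℕ} {K : Ch} (x : K.X k) (hx : K.d k (k + 1) x = 0) :
    sphere k ⟶ K :=
  HomologicalComplex.mkHomFromSingle (ratHom x) (by
    rintro j rfl
    apply rat_hom_ext
    rw [ModuleCat.comp_apply, ratHom_one]
    exact hx)

@[simp]
lemma sphereHom_sphereGen {k : ℕ} {K : Ch} (x : K.X k) (hx : K.d k (k + 1) x = 0) :
    (sphereHom x hx).f k (sphereGen k) = x := by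
  have e : (HomologicalComplex.singleObjXSelf (ComplexShape.up ℕ) k (ModuleCat.of ℚ ℚ)).inv ≫
      HomologicalComplex.Hom.f (sphereHom x hx) k = ratHom x := by
    refine (congrArg _ (HomologicalComplex.mkHomFromSingle_f _ _)).trans ?_
    exact Iso.inv_hom_id_assoc _ _
  exact (ConcreteCategory.congr_hom e (1 : ℚ)).trans (ratHom_one x)

/-- This is what makes restriction along `S^{k+1} → D^{k+1}` the differential: the top generator of
the disk is the differential of the bottom one. -/
lemma sphereToDisk_sphereGen (k : ℕ) :
    (sphereToDisk (k + 1)).f (k + 1) (sphereGen (k + 1)) =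
      (disk (k + 1)).d k (k + 1) (diskGen k) := by
  have h := HomologicalComplex.double_d (𝟙 (ModuleCat.of ℚ ℚ)) (rel_succ k)
    (Nat.succ_ne_self k).symm
  have e₁ : (HomologicalComplex.singleObjXSelf (ComplexShape.up ℕ) (k + 1)
      (ModuleCat.of ℚ ℚ)).inv ≫ HomologicalComplex.Hom.f (sphereToDisk (k + 1)) (k + 1) =
      (HomologicalComplex.doubleXIso₁ (𝟙 (ModuleCat.of ℚ ℚ)) (rel_succ k)
        (Nat.succ_ne_self k).symm).inv := by
    refine (congrArg _ (HomologicalComplex.mkHomFromSingle_f _ fun j _ => ?_)).trans ?_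
    · have hd := HomologicalComplex.double_d_eq_zero₀ (𝟙 (ModuleCat.of ℚ ℚ)) (rel_succ k)
        (k + 1) j (Nat.succ_ne_self k)
      exact (congrArg _ hd).trans comp_zero
    exact Iso.inv_hom_id_assoc _ _
  have e₂ : (HomologicalComplex.doubleXIso₀ (𝟙 (ModuleCat.of ℚ ℚ)) (rel_succ k)).inv ≫
      (HomologicalComplex.double (𝟙 (ModuleCat.of ℚ ℚ)) (rel_succ k)).d k (k + 1) =
      (HomologicalComplex.doubleXIso₁ (𝟙 (ModuleCat.of ℚ ℚ)) (rel_succ k)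
        (Nat.succ_ne_self k).symm).inv := by
    rw [h, Iso.inv_hom_id_assoc, Category.id_comp]
  exact ConcreteCategory.congr_hom (e₁.trans e₂.symm) (1 : ℚ)

end Generators

/-! ### Universal properties of the persistent disks and interval spheres -/

section KanExtensions

lemma bornAt_fac {s : ℝ≥0} {C : Ch} {X : PCh} (f : C ⟶ X.obj s) :
    bornAtUnit s C ≫ (bornAtDesc f).app s = f :=
  (bornAt s C).descOfIsLeftKanExtension_fac_app
    ((Functor.fromPUnit.{0} s).leftKanExtensionUnit (Functor.fromPUnit.{0} C)) X
    (Discrete.natTrans fun _ => f) ⟨⟨⟩⟩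

lemma bornAt_hom_ext {s : ℝ≥0} {C : Ch} {X : PCh} {f g : bornAt s C ⟶ X}
    (h : bornAtUnit s C ≫ f.app s = bornAtUnit s C ≫ g.app s) : f = g := by
  apply (bornAt s C).hom_ext_of_isLeftKanExtension
    ((Functor.fromPUnit.{0} s).leftKanExtensionUnit (Functor.fromPUnit.{0} C))
  ext ⟨⟨⟩⟩ : 2
  exact h

lemma bornAtDesc_eta {s : ℝ≥0} {C : Ch} {X : PCh} (f : bornAt s C ⟶ X) :
    bornAtDesc (bornAtUnit s C ≫ f.app s) = f :=
  bornAt_hom_ext (bornAt_fac _)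

variable {s t : ℝ≥0} (h : s < t) (k : ℕ)

/-- The canonical map from `S^k` to the value at time `s` of the interval sphere. -/
noncomputable def pSphereUnit₀ : sphere k ⟶ (pSphere h k).obj s :=
  ((ComposableArrows.mk₁ (homOfLE h.le)).leftKanExtensionUnit
      (ComposableArrows.mk₁ (sphereToDisk k))).app 0

/-- The canonical map from `D^k` to the value at time `t` of the interval sphere. -/
noncomputable def pSphereUnit₁ : disk k ⟶ (pSphere h k).obj t :=
  ((ComposableArrows.mk₁ (homOfLE h.le)).leftKanExtensionUnit
      (ComposableArrows.mk₁ (sphereToDisk k))).app 1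

/-- Naturality of the Kan extension unit along the arrow of `{s < t}`. -/
lemma pSphereUnit_comm :
    pSphereUnit₀ h k ≫ (pSphere h k).map (homOfLE h.le) = sphereToDisk k ≫ pSphereUnit₁ h k :=
  (((ComposableArrows.mk₁ (homOfLE h.le)).leftKanExtensionUnit
      (ComposableArrows.mk₁ (sphereToDisk k))).naturality (homOfLE zero_le_one : (0 : Fin 2) ⟶ 1)).symm

variable {h k}

lemma pSphere_hom_ext {X : PCh} {f g : pSphere h k ⟶ X}
    (h₀ : pSphereUnit₀ h k ≫ f.app s = pSphereUnit₀ h k ≫ g.app s)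
    (h₁ : pSphereUnit₁ h k ≫ f.app t = pSphereUnit₁ h k ≫ g.app t) : f = g := by
  apply (pSphere h k).hom_ext_of_isLeftKanExtension
    ((ComposableArrows.mk₁ (homOfLE h.le)).leftKanExtensionUnit
      (ComposableArrows.mk₁ (sphereToDisk k)))
  apply NatTrans.ext
  funext i
  match i with
  | 0 => exact h₀
  | 1 => exact h₁

/-- The map out of an interval sphere determined by a commutative square. -/
noncomputable def pSphereDesc {X : PCh} (a : sphere k ⟶ X.obj s) (b : disk k ⟶ X.obj t)
    (w : sphereToDisk k ≫ b = a ≫ X.map (homOfLE h.le)) : pSphere h k ⟶ X :=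
  (pSphere h k).descOfIsLeftKanExtension
    ((ComposableArrows.mk₁ (homOfLE h.le)).leftKanExtensionUnit
      (ComposableArrows.mk₁ (sphereToDisk k))) X
    (ComposableArrows.homMk₁
      (F := ComposableArrows.mk₁ (sphereToDisk k))
      (G := ComposableArrows.mk₁ (homOfLE h.le) ⋙ X) a b w)

lemma pSphere_fac₀ {X : PCh} (a : sphere k ⟶ X.obj s) (b : disk k ⟶ X.obj t)
    (w : sphereToDisk k ≫ b = a ≫ X.map (homOfLE h.le)) :
    pSphereUnit₀ h k ≫ (pSphereDesc a b w).app s = a :=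
  (pSphere h k).descOfIsLeftKanExtension_fac_app
    ((ComposableArrows.mk₁ (homOfLE h.le)).leftKanExtensionUnit
      (ComposableArrows.mk₁ (sphereToDisk k))) X _ 0

lemma pSphere_fac₁ {X : PCh} (a : sphere k ⟶ X.obj s) (b : disk k ⟶ X.obj t)
    (w : sphereToDisk k ≫ b = a ≫ X.map (homOfLE h.le)) :
    pSphereUnit₁ h k ≫ (pSphereDesc a b w).app t = b :=
  (pSphere h k).descOfIsLeftKanExtension_fac_app
    ((ComposableArrows.mk₁ (homOfLE h.le)).leftKanExtensionUnit
      (ComposableArrows.mk₁ (sphereToDisk k))) X _ 1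

lemma pSphereToDisk_fac₀ :
    pSphereUnit₀ h k ≫ (pSphereToDisk h k).app s = sphereToDisk k ≫ bornAtUnit s (disk k) :=
  pSphere_fac₀ (h := h) (X := pDisk s k) _ _ _

lemma pSphereToDisk_fac₁ :
    pSphereUnit₁ h k ≫ (pSphereToDisk h k).app t =
      bornAtUnit s (disk k) ≫ (pDisk s k).map (homOfLE h.le) :=
  pSphere_fac₁ (h := h) (X := pDisk s k) _ _ _

end KanExtensions

/-! ### Maps out of persistent disks and interval spheres as elements -/

section Evaluation

variable {X Y : PCh}

/-- Maps out of the persistent disk `𝔻^{k+1}_s` are elements of degree `k` at time `s`. -/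
noncomputable def pDiskEquiv (X : PCh) (s : ℝ≥0) (k : ℕ) :
    (pDisk s (k + 1) ⟶ X) ≃ (X.obj s).X k where
  toFun φ := (bornAtUnit s (disk (k + 1)) ≫ φ.app s).f k (diskGen k)
  invFun x := bornAtDesc (diskHom x)
  left_inv φ := by dsimp only; rw [diskHom_eta, bornAtDesc_eta]
  right_inv x := by dsimp only; rw [bornAt_fac, diskHom_diskGen]

lemma pDiskEquiv_comp {s : ℝ≥0} {k : ℕ} (φ : pDisk s (k + 1) ⟶ X) (f : X ⟶ Y) :
    pDiskEquiv Y s k (φ ≫ f) = (f.app s).f k (pDiskEquiv X s k φ) := rfl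

/-- Under corepresentability, `𝔻_t → 𝔻_s` becomes the structure map from time `s` to time `t`. -/
lemma pDiskEquiv_pDiskToDisk {s t : ℝ≥0} (h : s < t) {k : ℕ} (φ : pDisk s (k + 1) ⟶ X) :
    pDiskEquiv X t k (pDiskToDisk h (k + 1) ≫ φ) =
      (X.map (homOfLE h.le)).f k (pDiskEquiv X s k φ) := by
  have e : bornAtUnit t (disk (k + 1)) ≫ (pDiskToDisk h (k + 1) ≫ φ).app t =
      (bornAtUnit s (disk (k + 1)) ≫ φ.app s) ≫ X.map (homOfLE h.le) := by
    rw [NatTrans.comp_app, ← Category.assoc, pDiskToDisk, bornAt_fac, Category.assoc,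
      φ.naturality, Category.assoc]
  change (bornAtUnit t (disk (k + 1)) ≫ (pDiskToDisk h (k + 1) ≫ φ).app t).f k (diskGen k) = _
  rw [e]
  rfl

lemma pDisk_zero_hom_ext {s : ℝ≥0} (φ ψ : pDisk s 0 ⟶ X) : φ = ψ :=
  bornAt_hom_ext (disk_zero_hom_ext _ _)

/-- The element of degree `k` at time `s` given by a map out of `𝕊^k_{[s,∞)}`. -/
noncomputable def pSphereInfEval {s : ℝ≥0} {k : ℕ} (φ : pSphereInf s k ⟶ X) : (X.obj s).X k :=
  (bornAtUnit s (sphere k) ≫ φ.app s).f k (sphereGen k)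

/-- The map out of `𝕊^k_{[s,∞)}` given by a cocycle. -/
noncomputable def pSphereInfHom {s : ℝ≥0} {k : ℕ} (z : (X.obj s).X k)
    (hz : (X.obj s).d k (k + 1) z = 0) : pSphereInf s k ⟶ X :=
  bornAtDesc (sphereHom z hz)

@[simp]
lemma pSphereInfEval_hom {s : ℝ≥0} {k : ℕ} (z : (X.obj s).X k)
    (hz : (X.obj s).d k (k + 1) z = 0) : pSphereInfEval (pSphereInfHom z hz) = z := by
  rw [pSphereInfEval, pSphereInfHom, bornAt_fac, sphereHom_sphereGen]

lemma pSphereInf_ext {s : ℝ≥0} {k : ℕ} {φ ψ : pSphereInf s k ⟶ X}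
    (h : pSphereInfEval φ = pSphereInfEval ψ) : φ = ψ :=
  bornAt_hom_ext (sphere_hom_ext h)

lemma pSphereInfEval_comp {s : ℝ≥0} {k : ℕ} (φ : pSphereInf s k ⟶ X) (f : X ⟶ Y) :
    pSphereInfEval (φ ≫ f) = (f.app s).f k (pSphereInfEval φ) := rfl

lemma d_pSphereInfEval {s : ℝ≥0} {k : ℕ} (φ : pSphereInf s k ⟶ X) (l : ℕ) :
    (X.obj s).d k l (pSphereInfEval φ) = 0 := by
  rw [pSphereInfEval, ← hom_comm_apply, d_sphereGen, map_zero]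

lemma pSphereInfEval_toDisk {s : ℝ≥0} {k : ℕ} (φ : pDisk s (k + 1) ⟶ X) :
    pSphereInfEval (pSphereInfToDisk s (k + 1) ≫ φ) =
      (X.obj s).d k (k + 1) (pDiskEquiv X s k φ) := by
  have e : bornAtUnit s (sphere (k + 1)) ≫ (pSphereInfToDisk s (k + 1) ≫ φ).app s =
      sphereToDisk (k + 1) ≫ bornAtUnit s (disk (k + 1)) ≫ φ.app s := by
    rw [NatTrans.comp_app, ← Category.assoc, pSphereInfToDisk, bornAt_fac, Category.assoc]
  rw [pSphereInfEval, e, HomologicalComplex.comp_f, ModuleCat.comp_apply,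
    sphereToDisk_sphereGen, hom_comm_apply]
  rfl

variable {s t : ℝ≥0} {h : s < t} {k : ℕ}

/-- The cocycle at time `s` given by a map out of `𝕊^k_{[s,t)}`. -/
noncomputable def pSphereEval₀ (φ : pSphere h k ⟶ X) : (X.obj s).X k :=
  (pSphereUnit₀ h k ≫ φ.app s).f k (sphereGen k)

/-- The element at time `t` given by a map out of `𝕊^{k+1}_{[s,t)}`. -/
noncomputable def pSphereEval₁ (φ : pSphere h (k + 1) ⟶ X) : (X.obj t).X k :=
  (pSphereUnit₁ h (k + 1) ≫ φ.app t).f k (diskGen k)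

lemma pSphere_succ_ext {φ ψ : pSphere h (k + 1) ⟶ X} (h₀ : pSphereEval₀ φ = pSphereEval₀ ψ)
    (h₁ : pSphereEval₁ φ = pSphereEval₁ ψ) : φ = ψ :=
  pSphere_hom_ext (sphere_hom_ext h₀) (disk_hom_ext h₁)

lemma pSphere_zero_ext {φ ψ : pSphere h 0 ⟶ X} (h₀ : pSphereEval₀ φ = pSphereEval₀ ψ) : φ = ψ :=
  pSphere_hom_ext (sphere_hom_ext h₀) (disk_zero_hom_ext _ _)

lemma pSphereEval₀_comp (φ : pSphere h k ⟶ X) (f : X ⟶ Y) :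
    pSphereEval₀ (φ ≫ f) = (f.app s).f k (pSphereEval₀ φ) := rfl

lemma pSphereEval₁_comp (φ : pSphere h (k + 1) ⟶ X) (f : X ⟶ Y) :
    pSphereEval₁ (φ ≫ f) = (f.app t).f k (pSphereEval₁ φ) := rfl

lemma d_pSphereEval₀ (φ : pSphere h k ⟶ X) (l : ℕ) :
    (X.obj s).d k l (pSphereEval₀ φ) = 0 := by
  rw [pSphereEval₀, ← hom_comm_apply, d_sphereGen, map_zero]

/-- The commuting square defining `𝕊_{[s,t)}` says that the cocycle born at `s` acquires a chosen
primitive at `t`. -/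
lemma d_pSphereEval₁ (φ : pSphere h (k + 1) ⟶ X) :
    (X.obj t).d k (k + 1) (pSphereEval₁ φ) =
      (X.map (homOfLE h.le)).f (k + 1) (pSphereEval₀ φ) := by
  have e : (pSphereUnit₀ h (k + 1) ≫ φ.app s) ≫ X.map (homOfLE h.le) =
      sphereToDisk (k + 1) ≫ pSphereUnit₁ h (k + 1) ≫ φ.app t := by
    rw [Category.assoc, ← φ.naturality, ← Category.assoc, pSphereUnit_comm, Category.assoc]
  rw [pSphereEval₀, ← ModuleCat.comp_apply, ← HomologicalComplex.comp_f, e,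
    HomologicalComplex.comp_f, ModuleCat.comp_apply, sphereToDisk_sphereGen, hom_comm_apply]
  rfl

/-- The map out of `𝕊^{k+1}_{[s,t)}` given by a cocycle at time `s` and a primitive of its image
at time `t`. -/
noncomputable def pSphereHom (z : (X.obj s).X (k + 1)) (w : (X.obj t).X k)
    (hz : (X.obj s).d (k + 1) (k + 1 + 1) z = 0)
    (hw : (X.obj t).d k (k + 1) w = (X.map (homOfLE h.le)).f (k + 1) z) :
    pSphere h (k + 1) ⟶ X :=
  pSphereDesc (sphereHom z hz) (diskHom w) (by
    apply sphere_hom_ext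
    rw [HomologicalComplex.comp_f, ModuleCat.comp_apply, sphereToDisk_sphereGen, hom_comm_apply,
      diskHom_diskGen, hw, HomologicalComplex.comp_f, ModuleCat.comp_apply, sphereHom_sphereGen])

@[simp]
lemma pSphereEval₀_hom (z : (X.obj s).X (k + 1)) (w : (X.obj t).X k)
    (hz : (X.obj s).d (k + 1) (k + 1 + 1) z = 0)
    (hw : (X.obj t).d k (k + 1) w = (X.map (homOfLE h.le)).f (k + 1) z) :
    pSphereEval₀ (pSphereHom (h := h) z w hz hw) = z := by
  rw [pSphereEval₀, pSphereHom, pSphere_fac₀, sphereHom_sphereGen]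

@[simp]
lemma pSphereEval₁_hom (z : (X.obj s).X (k + 1)) (w : (X.obj t).X k)
    (hz : (X.obj s).d (k + 1) (k + 1 + 1) z = 0)
    (hw : (X.obj t).d k (k + 1) w = (X.map (homOfLE h.le)).f (k + 1) z) :
    pSphereEval₁ (pSphereHom (h := h) z w hz hw) = w := by
  rw [pSphereEval₁, pSphereHom, pSphere_fac₁, diskHom_diskGen]

lemma pSphereEval₀_toDisk (φ : pDisk s (k + 1) ⟶ X) :
    pSphereEval₀ (pSphereToDisk h (k + 1) ≫ φ) =
      (X.obj s).d k (k + 1) (pDiskEquiv X s k φ) := by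
  have e : pSphereUnit₀ h (k + 1) ≫ (pSphereToDisk h (k + 1) ≫ φ).app s =
      sphereToDisk (k + 1) ≫ bornAtUnit s (disk (k + 1)) ≫ φ.app s := by
    rw [NatTrans.comp_app, ← Category.assoc, pSphereToDisk_fac₀, Category.assoc]
  rw [pSphereEval₀, e, HomologicalComplex.comp_f, ModuleCat.comp_apply,
    sphereToDisk_sphereGen, hom_comm_apply]
  rfl

lemma pSphereEval₁_toDisk (φ : pDisk s (k + 1) ⟶ X) :
    pSphereEval₁ (pSphereToDisk h (k + 1) ≫ φ) =
      (X.map (homOfLE h.le)).f k (pDiskEquiv X s k φ) := by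
  have e : pSphereUnit₁ h (k + 1) ≫ (pSphereToDisk h (k + 1) ≫ φ).app t =
      (bornAtUnit s (disk (k + 1)) ≫ φ.app s) ≫ X.map (homOfLE h.le) := by
    rw [NatTrans.comp_app, ← Category.assoc, pSphereToDisk_fac₁, Category.assoc,
      φ.naturality, Category.assoc]
  rw [pSphereEval₁, e]
  rfl

end Evaluation

/-! ### Lifting properties in terms of elements -/

section Lifting

/-- The elementwise description of the fibrations of the interval-sphere model structure. -/
structure IsFib {X Y : PCh} (f : X ⟶ Y) : Prop where
  surj (s : ℝ≥0) (n : ℕ) (y : (Y.obj s).X n) : ∃ x, (f.app s).f n x = y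
  lift {s t : ℝ≥0} (h : s < t) {n : ℕ} (y : (Y.obj s).X n) (x : (X.obj t).X n)
    (hxy : (f.app t).f n x = (Y.map (homOfLE h.le)).f n y) :
    ∃ x' : (X.obj s).X n, (f.app s).f n x' = y ∧ (X.map (homOfLE h.le)).f n x' = x

/-- The elementwise description of the trivial fibrations of the interval-sphere model
structure. -/
structure IsTrivFib {X Y : PCh} (f : X ⟶ Y) : Prop where
  zero (s : ℝ≥0) (z : (X.obj s).X 0) (hz : (X.obj s).d 0 1 z = 0)
    (hfz : (f.app s).f 0 z = 0) : z = 0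
  inf (s : ℝ≥0) {n : ℕ} (z : (X.obj s).X (n + 1)) (y : (Y.obj s).X n)
    (hz : (X.obj s).d (n + 1) (n + 1 + 1) z = 0)
    (hy : (Y.obj s).d n (n + 1) y = (f.app s).f (n + 1) z) :
    ∃ x, (X.obj s).d n (n + 1) x = z ∧ (f.app s).f n x = y
  fin {s t : ℝ≥0} (h : s < t) {n : ℕ} (z : (X.obj s).X (n + 1)) (w : (X.obj t).X n)
    (y : (Y.obj s).X n) (hz : (X.obj s).d (n + 1) (n + 1 + 1) z = 0)
    (hw : (X.obj t).d n (n + 1) w = (X.map (homOfLE h.le)).f (n + 1) z)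
    (hy : (Y.obj s).d n (n + 1) y = (f.app s).f (n + 1) z)
    (hwy : (f.app t).f n w = (Y.map (homOfLE h.le)).f n y) :
    ∃ x, (X.obj s).d n (n + 1) x = z ∧ (f.app s).f n x = y ∧
      (X.map (homOfLE h.le)).f n x = w

variable {X Y : PCh} {f : X ⟶ Y}

/-- The maps `0 → 𝔻_s` encode surjectivity at each time, and `𝔻_t → 𝔻_s` encode surjectivity of `X_s
→ Y_s ×_{Y_t} X_t`. The index `k = 0` imposes nothing, since `𝔻^0_s = 0`. -/
lemma setJ_rlp_iff : setJ.rlp f ↔ IsFib f := by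
  constructor
  · intro hf
    refine ⟨fun s n y => ?_, fun {s t} h n y x hxy => ?_⟩
    · have := hf _ (setJ.inf (n + 1) s)
      have sq : CommSq 0 (0 : (0 : PCh) ⟶ pDisk s (n + 1)) f ((pDiskEquiv Y s n).symm y) :=
        ⟨by rw [zero_comp, zero_comp]⟩
      refine ⟨pDiskEquiv X s n sq.lift, ?_⟩
      rw [← pDiskEquiv_comp, sq.fac_right, Equiv.apply_symm_apply]
    · have := hf _ (setJ.fin (n + 1) h)
      have sq : CommSq ((pDiskEquiv X t n).symm x) (pDiskToDisk h (n + 1)) f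
          ((pDiskEquiv Y s n).symm y) := ⟨by
        apply (pDiskEquiv Y t n).injective
        rw [pDiskEquiv_comp, pDiskEquiv_pDiskToDisk, Equiv.apply_symm_apply,
          Equiv.apply_symm_apply, hxy]⟩
      refine ⟨pDiskEquiv X s n sq.lift, ?_, ?_⟩
      · rw [← pDiskEquiv_comp, sq.fac_right, Equiv.apply_symm_apply]
      · rw [← pDiskEquiv_pDiskToDisk h, sq.fac_left, Equiv.apply_symm_apply]
  · rintro hf _ _ _ (⟨k, h⟩ | ⟨k, s⟩)
    · refine ⟨fun {u v} sq => ?_⟩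
      cases k with
      | zero => exact ⟨⟨⟨0, pDisk_zero_hom_ext _ _, pDisk_zero_hom_ext _ _⟩⟩⟩
      | succ n =>
        obtain ⟨x, hx, hx'⟩ := hf.lift h (pDiskEquiv _ _ n v) (pDiskEquiv _ _ n u) (by
          rw [← pDiskEquiv_comp, sq.w, pDiskEquiv_pDiskToDisk])
        refine ⟨⟨⟨(pDiskEquiv _ _ n).symm x, ?_, ?_⟩⟩⟩
        · apply (pDiskEquiv _ _ n).injective
          rw [pDiskEquiv_pDiskToDisk, Equiv.apply_symm_apply, hx']
        · apply (pDiskEquiv _ _ n).injective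
          rw [pDiskEquiv_comp, Equiv.apply_symm_apply, hx]
    · refine ⟨fun {u v} sq => ?_⟩
      cases k with
      | zero => exact ⟨⟨⟨0, (isZero_zero PCh).eq_of_src _ _, pDisk_zero_hom_ext _ _⟩⟩⟩
      | succ n =>
        obtain ⟨x, hx⟩ := hf.surj s n (pDiskEquiv _ _ n v)
        refine ⟨⟨⟨(pDiskEquiv _ _ n).symm x, (isZero_zero PCh).eq_of_src _ _, ?_⟩⟩⟩
        apply (pDiskEquiv _ _ n).injective
        rw [pDiskEquiv_comp, Equiv.apply_symm_apply, hx]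

/-- A lifting problem is a cocycle of `X` together with a primitive of its image in `Y`, and
possibly a primitive in `X` at time `t`; a lift is a primitive compatible with these data. For `k =
0` there are no primitives, and both kinds of sphere only ask that a cocycle in the kernel vanish,
so `zero` alone covers them. -/
lemma setI_rlp_iff : setI.rlp f ↔ IsTrivFib f := by
  constructor
  · intro hf
    refine ⟨fun s z hz hfz => ?_, fun s n z y hz hy => ?_, fun {s t} h n z w y hz hw hy hwy => ?_⟩
    · have := hf _ (setI.inf 0 s)
      have sq : CommSq (pSphereInfHom z hz) (pSphereInfToDisk s 0) f 0 := ⟨by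
        apply pSphereInf_ext
        rw [pSphereInfEval_comp, pSphereInfEval_hom, hfz, comp_zero]
        rfl⟩
      have e := pSphereInfEval_hom z hz
      rw [← sq.fac_left, pDisk_zero_hom_ext sq.lift 0, comp_zero] at e
      exact e.symm
    · have := hf _ (setI.inf (n + 1) s)
      have sq : CommSq (pSphereInfHom z hz) (pSphereInfToDisk s (n + 1)) f
          ((pDiskEquiv Y s n).symm y) := ⟨by
        apply pSphereInf_ext
        rw [pSphereInfEval_comp, pSphereInfEval_hom, pSphereInfEval_toDisk,
          Equiv.apply_symm_apply, hy]⟩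
      refine ⟨pDiskEquiv X s n sq.lift, ?_, ?_⟩
      · rw [← pSphereInfEval_toDisk, sq.fac_left, pSphereInfEval_hom]
      · rw [← pDiskEquiv_comp, sq.fac_right, Equiv.apply_symm_apply]
    · have := hf _ (setI.fin (n + 1) h)
      have sq : CommSq (pSphereHom z w hz hw) (pSphereToDisk h (n + 1)) f
          ((pDiskEquiv Y s n).symm y) := ⟨by
        apply pSphere_succ_ext
        · rw [pSphereEval₀_comp, pSphereEval₀_hom, pSphereEval₀_toDisk,
            Equiv.apply_symm_apply, hy]
        · rw [pSphereEval₁_comp, pSphereEval₁_hom, pSphereEval₁_toDisk,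
            Equiv.apply_symm_apply, hwy]⟩
      refine ⟨pDiskEquiv X s n sq.lift, ?_, ?_, ?_⟩
      · rw [← pSphereEval₀_toDisk (h := h), sq.fac_left, pSphereEval₀_hom]
      · rw [← pDiskEquiv_comp, sq.fac_right, Equiv.apply_symm_apply]
      · rw [← pSphereEval₁_toDisk (h := h), sq.fac_left, pSphereEval₁_hom]
  · rintro hf _ _ _ (⟨k, h⟩ | ⟨k, s⟩)
    · refine ⟨fun {u v} sq => ?_⟩
      cases k with
      | zero =>
        refine ⟨⟨⟨0, pSphere_zero_ext ?_, pDisk_zero_hom_ext _ _⟩⟩⟩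
        rw [comp_zero]
        refine (hf.zero _ _ (d_pSphereEval₀ u 1) ?_).symm
        rw [← pSphereEval₀_comp, sq.w, pDisk_zero_hom_ext v 0, comp_zero]
        rfl
      | succ n =>
        obtain ⟨x, hx₀, hx, hx₁⟩ := hf.fin h (pSphereEval₀ u) (pSphereEval₁ u)
          (pDiskEquiv _ _ n v) (d_pSphereEval₀ _ _) (d_pSphereEval₁ _)
          (by rw [← pSphereEval₀_comp, sq.w, pSphereEval₀_toDisk])
          (by rw [← pSphereEval₁_comp, sq.w, pSphereEval₁_toDisk])
        refine ⟨⟨⟨(pDiskEquiv _ _ n).symm x, pSphere_succ_ext ?_ ?_, ?_⟩⟩⟩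
        · rw [pSphereEval₀_toDisk, Equiv.apply_symm_apply, hx₀]
        · rw [pSphereEval₁_toDisk, Equiv.apply_symm_apply, hx₁]
        · apply (pDiskEquiv _ _ n).injective
          rw [pDiskEquiv_comp, Equiv.apply_symm_apply, hx]
    · refine ⟨fun {u v} sq => ?_⟩
      cases k with
      | zero =>
        refine ⟨⟨⟨0, pSphereInf_ext ?_, pDisk_zero_hom_ext _ _⟩⟩⟩
        rw [comp_zero]
        refine (hf.zero _ _ (d_pSphereInfEval u 1) ?_).symm
        rw [← pSphereInfEval_comp, sq.w, pDisk_zero_hom_ext v 0, comp_zero]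
        rfl
      | succ n =>
        obtain ⟨x, hx₀, hx⟩ := hf.inf s (pSphereInfEval u) (pDiskEquiv _ _ n v)
          (d_pSphereInfEval _ _) (by rw [← pSphereInfEval_comp, sq.w, pSphereInfEval_toDisk])
        refine ⟨⟨⟨(pDiskEquiv _ _ n).symm x, pSphereInf_ext ?_, ?_⟩⟩⟩
        · rw [pSphereInfEval_toDisk, Equiv.apply_symm_apply, hx₀]
        · apply (pDiskEquiv _ _ n).injective
          rw [pDiskEquiv_comp, Equiv.apply_symm_apply, hx]

end Lifting

/-! ### Trivial fibrations are the fibrations that are quasi-isomorphisms -/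

section TrivialFibrations

/-- The kernel of a surjective quasi-isomorphism is acyclic. -/
lemma exists_primitive_in_kernel {K L : Ch} (g : K ⟶ L) [QuasiIso g]
    (hg : ∀ (n : ℕ) (y : L.X n), ∃ x, g.f n x = y) {n : ℕ} (c : K.X n)
    (hc : K.d n (n + 1) c = 0) (hgc : g.f n c = 0) :
    ∃ (m : ℕ) (e : K.X m), K.d m n e = c ∧ g.f m e = 0 := by
  have hq := (quasiIso_iff_cocycles g).1 inferInstance
  obtain ⟨m, e₀, rfl⟩ := (hq n).1 c hc ⟨n, 0, by rw [map_zero, hgc]⟩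
  -- If `m + 1 = n`, the primitive `e₀` need not lie in the kernel, but `g e₀` is a cocycle: it is
  -- `g x` up to a coboundary, with `x` a cocycle. Lifting the primitive `y` to `y'` gives the
  -- correction `e₀ - x - d y'`. Otherwise the differential is zero and so is the cocycle.
  by_cases hmn : m + 1 = n
  · subst hmn
    obtain ⟨x, hx, l, y, hy⟩ := (hq m).2 (g.f m e₀) (by rw [← hom_comm_apply, hgc])
    obtain ⟨y', rfl⟩ := hg _ y
    refine ⟨m, e₀ - x - K.d l m y', ?_, ?_⟩
    · rw [map_sub, map_sub, hx, d_apply_d_apply, sub_zero, sub_zero]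
    · rw [map_sub, map_sub, hom_comm_apply, hy, sub_self]
  · refine ⟨m, 0, ?_, map_zero _⟩
    rw [map_zero, K.shape m n (by simpa using hmn)]
    rfl

lemma exists_primitive_in_kernel_succ {K L : Ch} (g : K ⟶ L) [QuasiIso g]
    (hg : ∀ (n : ℕ) (y : L.X n), ∃ x, g.f n x = y) {n : ℕ} (c : K.X (n + 1))
    (hc : K.d (n + 1) (n + 1 + 1) c = 0) (hgc : g.f (n + 1) c = 0) :
    ∃ e : K.X n, K.d n (n + 1) e = c ∧ g.f n e = 0 := by
  obtain ⟨m, e, rfl, he⟩ := exists_primitive_in_kernel g hg c hc hgc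
  by_cases hmn : m = n
  · subst hmn
    exact ⟨e, rfl, he⟩
  · refine ⟨0, ?_, map_zero _⟩
    rw [map_zero, K.shape m (n + 1) (by simpa using hmn)]
    rfl

variable {X Y : PCh} {f : X ⟶ Y}

lemma map_app_apply (f : X ⟶ Y) {s t : ℝ≥0} (i : s ⟶ t) (n : ℕ) (x : (X.obj s).X n) :
    (f.app t).f n ((X.map i).f n x) = (Y.map i).f n ((f.app s).f n x) := by
  rw [← ModuleCat.comp_apply, ← ModuleCat.comp_apply, ← HomologicalComplex.comp_f,
    ← HomologicalComplex.comp_f, f.naturality]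

/-- Apply the lifting property twice: for the zero cocycle one degree higher, it lifts `d y` to a
cocycle `z`; for `z` itself, it lifts `y` to an element with differential `z`. -/
lemma IsTrivFib.isFib (hf : IsTrivFib f) : IsFib f := by
  have cocycle (s : ℝ≥0) (n : ℕ) (y : (Y.obj s).X n) :
      ∃ z, (X.obj s).d (n + 1) (n + 1 + 1) z = 0 ∧
        (f.app s).f (n + 1) z = (Y.obj s).d n (n + 1) y :=
    hf.inf s 0 ((Y.obj s).d n (n + 1) y) (map_zero _)
      (by rw [d_apply_d_apply, map_zero])
  refine ⟨fun s n y => ?_, fun {s t} h n y x hxy => ?_⟩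
  · obtain ⟨z, hz, hfz⟩ := cocycle s n y
    obtain ⟨x, -, hx⟩ := hf.inf s z y hz hfz.symm
    exact ⟨x, hx⟩
  · obtain ⟨z, hz, hfz, hzx⟩ := hf.fin h 0 ((X.obj t).d n (n + 1) x) ((Y.obj s).d n (n + 1) y)
      (map_zero _) (by rw [d_apply_d_apply, map_zero]) (by rw [d_apply_d_apply, map_zero])
      (by rw [hom_comm_apply, hxy, hom_comm_apply])
    obtain ⟨x', -, h₁, h₂⟩ := hf.fin h z x y hz hzx.symm hfz.symm hxy
    exact ⟨x', h₁, h₂⟩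

/-- Only the condition at a single time is used. Injectivity is the lifting of primitives; for
surjectivity, take `z = 0`, so that cocycles lift to cocycles on the nose. -/
lemma IsTrivFib.quasiIso (hf : IsTrivFib f) (s : ℝ≥0) : QuasiIso (f.app s) := by
  rw [quasiIso_iff_cocycles]
  refine fun n => ⟨fun x hx hb => ?_, fun y hy => ?_⟩
  · cases n with
    | zero =>
      rw [isBdry_zero_iff] at hb ⊢
      exact hf.zero s x hx hb
    | succ n =>
      rw [isBdry_succ_iff] at hb ⊢
      obtain ⟨y, hy⟩ := hb
      obtain ⟨x', hx', -⟩ := hf.inf s x y hx hy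
      exact ⟨x', hx'⟩
  · obtain ⟨x, hx, rfl⟩ := hf.inf s 0 y (map_zero _) (by rw [hy, map_zero])
    exact ⟨x, hx, n, 0, by rw [map_zero, sub_self]⟩

lemma IsFib.isTrivFib (hf : IsFib f) (hq : pointwiseQuasiIso f) : IsTrivFib f := by
  refine ⟨fun s z hz hfz => ?_, fun s n z y hz hy => ?_, fun {s t} h n z w y hz hw hy hwy => ?_⟩
  · have := hq s
    obtain ⟨m, e, rfl, -⟩ := exists_primitive_in_kernel (f.app s) (hf.surj s) z hz hfz
    exact (isBdry_zero_iff _ _).1 ⟨m, e, rfl⟩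
  · have := hq s
    obtain ⟨x, rfl⟩ := hf.surj s n y
    obtain ⟨e, he, hfe⟩ := exists_primitive_in_kernel_succ (f.app s) (hf.surj s)
      (z - (X.obj s).d n (n + 1) x) (by rw [map_sub, hz, d_apply_d_apply, sub_zero])
      (by rw [map_sub, hom_comm_apply, hy, sub_self])
    exact ⟨x + e, by rw [map_add, he, add_sub_cancel], by rw [map_add, hfe, add_zero]⟩
  -- The fibration property gives `x` over `y` restricting to `w`, and the error `z - d x` has a
  -- primitive `e` in the kernel of `f`. At time `t` this `e` is a cocycle in the kernel, hence `d
  -- g` with `g` in the kernel. Lifting `g` to `g'` over `0` and subtracting `d g'` makes `e` vanish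
  -- at time `t` without changing its differential.
  · have := hq s
    have := hq t
    obtain ⟨x, rfl, rfl⟩ := hf.lift h y w hwy
    obtain ⟨e, he, hfe⟩ := exists_primitive_in_kernel_succ (f.app s) (hf.surj s)
      (z - (X.obj s).d n (n + 1) x) (by rw [map_sub, hz, d_apply_d_apply, sub_zero])
      (by rw [map_sub, hom_comm_apply, hy, sub_self])
    obtain ⟨m, g, hg, hfg⟩ := exists_primitive_in_kernel (f.app t) (hf.surj t)
      ((X.map (homOfLE h.le)).f n e)
      (by rw [← hom_comm_apply, he, map_sub, hom_comm_apply, hw, sub_self])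
      (by rw [map_app_apply, hfe, map_zero])
    obtain ⟨g', hg', rfl⟩ := hf.lift h 0 g (by rw [hfg, map_zero])
    refine ⟨x + (e - (X.obj s).d m n g'), ?_, ?_, ?_⟩
    · rw [map_add, map_sub, he, d_apply_d_apply, sub_zero, add_sub_cancel]
    · rw [map_add, map_sub, hom_comm_apply, hfe, hg', map_zero, sub_zero, add_zero]
    · rw [map_add, map_sub, hom_comm_apply, hg, sub_self, add_zero]

/-- The trivial fibrations of the interval-sphere model structure are the fibrations which are
pointwise quasi-isomorphisms. -/
lemma setI_rlp_iff_setJ_rlp : setI.rlp f ↔ setJ.rlp f ∧ pointwiseQuasiIso f := by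
  rw [setI_rlp_iff, setJ_rlp_iff]
  exact ⟨fun h => ⟨h.isFib, h.quasiIso⟩, fun h => h.1.isTrivFib h.2⟩

end TrivialFibrations

namespace CDGA

/-! ### Products of CDGAs -/

section Products

variable {ι : Type} (A : ι → CDGA)

/-- The product of a family of cochain complexes, with elements the dependent functions. -/
def piComplex (K : ι → Ch) : Ch where
  X n := ModuleCat.of ℚ (∀ i, (K i).X n)
  d m n := ModuleCat.ofHom (LinearMap.pi fun i => ((K i).d m n).hom ∘ₗ LinearMap.proj i)
  shape m n h := by
    ext x i
    change (K i).d m n (x i) = 0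
    rw [(K i).shape m n h]
    rfl
  d_comp_d' l m n _ _ := by
    ext x i
    exact d_apply_d_apply (K i) (x i)

/-- The product of a family of CDGAs, with elements the dependent functions. -/
def pi : CDGA where
  cx := piComplex fun i => (A i).cx
  one := fun i => (A i).one
  mul h := LinearMap.mk₂ ℚ (fun x y i => (A i).mul h (x i) (y i))
    (fun _ _ _ => funext fun _ => LinearMap.map_add₂ _ _ _ _)
    (fun _ _ _ => funext fun _ => LinearMap.map_smul₂ _ _ _ _)
    (fun _ _ _ => funext fun _ => map_add _ _ _)
    (fun _ _ _ => funext fun _ => map_smul _ _ _)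
  one_mul x := funext fun i => (A i).one_mul (x i)
  mul_one x := funext fun i => (A i).mul_one (x i)
  mul_assoc hij hjk h₁ h₂ x y z := funext fun i => (A i).mul_assoc hij hjk h₁ h₂ (x i) (y i) (z i)
  mul_comm h h' x y := funext fun i => (A i).mul_comm h h' (x i) (y i)
  leibniz h h₁ h₂ x y := funext fun i => (A i).leibniz h h₁ h₂ (x i) (y i)

/-- The projection from the product. -/
def piProj (i : ι) : pi A ⟶ A i where
  hom :=
    { f := fun _ => ModuleCat.ofHom (LinearMap.proj i)
      comm' := fun _ _ _ => rfl }
  map_one := rfl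
  map_mul _ _ _ := rfl

variable {A}

/-- The map to the product determined by its components. -/
def piLift {B : CDGA} (f : ∀ i, B ⟶ A i) : B ⟶ pi A where
  hom :=
    { f := fun n => ModuleCat.ofHom (LinearMap.pi fun i => ((f i).hom.f n).hom)
      comm' := fun m n _ => by
        ext x
        funext i
        exact (hom_comm_apply (f i).hom m n x).symm }
  map_one := funext fun i => (f i).map_one
  map_mul h x y := funext fun i => (f i).map_mul h x y

lemma piLift_proj {B : CDGA} (f : ∀ i, B ⟶ A i) (i : ι) : piLift f ≫ piProj A i = f i := rfl

lemma pi_hom_ext {B : CDGA} {f g : B ⟶ pi A} (h : ∀ i, f ≫ piProj A i = g ≫ piProj A i) :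
    f = g := by
  ext n x
  funext i
  exact congrArg (fun φ : B ⟶ A i => φ.hom.f n x) (h i)

instance : HasProducts.{0} CDGA :=
  hasProducts_of_limit_fans (fun A => Fan.mk (pi A) (piProj A)) fun _ =>
    Fan.IsLimit.mk _ (fun s => piLift s.proj) (fun _ _ => piLift_proj _ _)
      (fun _ _ hm => pi_hom_ext fun i => hm i)

end Products

/-! ### Equalizers of CDGAs -/

section Equalizers

variable {A B : CDGA} (f g : A ⟶ B)

/-- The equalizer of two cochain maps, as a subcomplex. -/
def eqComplex {K L : Ch} (f g : K ⟶ L) : Ch where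
  X n := ModuleCat.of ℚ (LinearMap.eqLocus (f.f n).hom (g.f n).hom)
  d m n := ModuleCat.ofHom ((K.d m n).hom.restrict fun x hx => by
    change f.f n (K.d m n x) = g.f n (K.d m n x)
    rw [hom_comm_apply, hom_comm_apply]
    exact congrArg _ hx)
  shape m n h := by
    ext x
    change K.d m n x.1 = 0
    rw [K.shape m n h]
    rfl
  d_comp_d' l m n _ _ := by
    ext x
    exact d_apply_d_apply K x.1

/-- The equalizer of two morphisms of CDGAs, as a sub-CDGA. -/
def eqObj : CDGA where
  cx := eqComplex f.hom g.hom
  one := ⟨A.one, f.map_one.trans g.map_one.symm⟩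
  mul h := LinearMap.mk₂ ℚ
    (fun x y => ⟨A.mul h x.1 y.1, by
      have hx : f.hom.f _ x.1 = g.hom.f _ x.1 := x.2
      have hy : f.hom.f _ y.1 = g.hom.f _ y.1 := y.2
      change f.hom.f _ (A.mul h x.1 y.1) = g.hom.f _ (A.mul h x.1 y.1)
      rw [f.map_mul, g.map_mul, hx, hy]⟩)
    (fun _ _ _ => Subtype.ext (LinearMap.map_add₂ _ _ _ _))
    (fun _ _ _ => Subtype.ext (LinearMap.map_smul₂ _ _ _ _))
    (fun _ _ _ => Subtype.ext (map_add _ _ _))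
    (fun _ _ _ => Subtype.ext (map_smul _ _ _))
  one_mul x := Subtype.ext (A.one_mul x.1)
  mul_one x := Subtype.ext (A.mul_one x.1)
  mul_assoc hij hjk h₁ h₂ x y z := Subtype.ext (A.mul_assoc hij hjk h₁ h₂ x.1 y.1 z.1)
  mul_comm h h' x y := Subtype.ext (A.mul_comm h h' x.1 y.1)
  leibniz h h₁ h₂ x y := Subtype.ext (A.leibniz h h₁ h₂ x.1 y.1)

/-- The inclusion of the equalizer. -/
def eqι : eqObj f g ⟶ A where
  hom :=
    { f := fun _ => ModuleCat.ofHom (Submodule.subtype _)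
      comm' := fun _ _ _ => rfl }
  map_one := rfl
  map_mul _ _ _ := rfl

variable {f g}

/-- The map to the equalizer determined by a map equalizing the two morphisms. -/
def eqLift {C : CDGA} (k : C ⟶ A) (w : k ≫ f = k ≫ g) : C ⟶ eqObj f g where
  hom :=
    { f := fun n => ModuleCat.ofHom ((k.hom.f n).hom.codRestrict _ fun x =>
        congrArg (fun φ : C ⟶ B => φ.hom.f n x) w)
      comm' := fun m n _ => by
        ext x
        exact Subtype.ext (hom_comm_apply k.hom m n x).symm }
  map_one := Subtype.ext k.map_one
  map_mul h x y := Subtype.ext (k.map_mul h x y)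

lemma eq_condition : eqι f g ≫ f = eqι f g ≫ g := by
  ext n x
  exact x.2

lemma eq_hom_ext {C : CDGA} {k l : C ⟶ eqObj f g} (h : k ≫ eqι f g = l ≫ eqι f g) : k = l := by
  ext n x
  exact Subtype.ext (congrArg (fun φ : C ⟶ A => φ.hom.f n x) h)

instance : HasEqualizers CDGA := by
  refine @hasEqualizers_of_hasLimit_parallelPair CDGA _ fun {A B f g} =>
    ⟨⟨⟨Fork.ofι (eqι f g) eq_condition, ?_⟩⟩⟩
  exact Fork.IsLimit.mk _
    (fun s => eqLift s.ι s.condition) (fun s => rfl) (fun s m hm => eq_hom_ext hm)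

end Equalizers

instance : HasLimitsOfSize.{0, 0} CDGA := has_limits_of_hasEqualizers_and_products

/-! ### Differential graded ideals and quotients -/

/-- A differential graded ideal of a CDGA. -/
structure DGIdeal (A : CDGA) : Type where
  /-- the homogeneous components -/
  carrier (n : ℕ) : Submodule ℚ (A.cx.X n)
  mul_mem {i j k : ℕ} (h : i + j = k) (x : A.cx.X i) {y : A.cx.X j} (hy : y ∈ carrier j) :
    A.mul h x y ∈ carrier k
  d_mem {m : ℕ} (n : ℕ) {x : A.cx.X m} (hx : x ∈ carrier m) : A.cx.d m n x ∈ carrier n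

namespace DGIdeal

variable {A B : CDGA}

/-- Graded commutativity makes a left ideal two-sided. -/
lemma mul_mem_right (I : DGIdeal A) {i j k : ℕ} (h : i + j = k) {x : A.cx.X i}
    (hx : x ∈ I.carrier i) (y : A.cx.X j) : A.mul h x y ∈ I.carrier k := by
  rw [A.mul_comm h ((Nat.add_comm j i).trans h)]
  exact Submodule.smul_mem _ _ (I.mul_mem _ y hx)

/-- The ideal generated by a family of relations. -/
def span (R : ∀ n, A.cx.X n → Prop) : DGIdeal A where
  carrier n :=
    { carrier := {x | ∀ I : DGIdeal A, (∀ n x, R n x → x ∈ I.carrier n) → x ∈ I.carrier n}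
      add_mem' hx hy I hI := add_mem (hx I hI) (hy I hI)
      zero_mem' _ _ := zero_mem _
      smul_mem' c _ hx I hI := Submodule.smul_mem _ c (hx I hI) }
  mul_mem h x _ hy I hI := I.mul_mem h x (hy I hI)
  d_mem n _ hx I hI := I.d_mem n (hx I hI)

lemma subset_span {R : ∀ n, A.cx.X n → Prop} {n : ℕ} {x : A.cx.X n} (hx : R n x) :
    x ∈ (span R).carrier n :=
  fun _ hI => hI n x hx

/-- The kernel of a morphism of CDGAs. -/
def ker (f : A ⟶ B) : DGIdeal A where
  carrier n := LinearMap.ker (f.hom.f n).hom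
  mul_mem h x y hy := by
    have hy' : f.hom.f _ y = 0 := hy
    change f.hom.f _ (A.mul h x y) = 0
    rw [f.map_mul, hy', map_zero]
  d_mem {m} n x hx := by
    have hx' : f.hom.f _ x = 0 := hx
    change f.hom.f _ (A.cx.d m n x) = 0
    rw [hom_comm_apply, hx', map_zero]

/-- The span is an intersection of ideals, and the kernel is one of those intersected. -/
lemma span_le_ker {R : ∀ n, A.cx.X n → Prop} (f : A ⟶ B) (hf : ∀ n x, R n x → f.hom.f n x = 0)
    {n : ℕ} {x : A.cx.X n} (hx : x ∈ (span R).carrier n) : f.hom.f n x = 0 :=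
  hx (ker f) hf

variable (I : DGIdeal A)

/-- The multiplication on the quotient by an ideal. -/
def quotientMul {i j k : ℕ} (h : i + j = k) :
    (A.cx.X i ⧸ I.carrier i) →ₗ[ℚ] (A.cx.X j ⧸ I.carrier j) →ₗ[ℚ] (A.cx.X k ⧸ I.carrier k) :=
  -- The product descends in the first variable, then, after a flip, in the second.
  ((I.carrier j).liftQ ((I.carrier i).liftQ ((A.mul h).compr₂ (I.carrier k).mkQ) (by
    intro x hx
    ext y
    exact (Submodule.Quotient.mk_eq_zero _).2 (I.mul_mem_right h hx y))).flip (by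
    intro y hy
    apply Submodule.linearMap_qext
    ext x
    exact (Submodule.Quotient.mk_eq_zero _).2 (I.mul_mem h x hy))).flip

/-- The quotient complex. -/
def quotientComplex : Ch where
  X n := ModuleCat.of ℚ (A.cx.X n ⧸ I.carrier n)
  d m n := ModuleCat.ofHom ((I.carrier m).mapQ (I.carrier n) (A.cx.d m n).hom
    fun _ hx => I.d_mem n hx)
  shape m n h := by
    ext x
    change (I.carrier n).mkQ (A.cx.d m n x) = 0
    rw [A.cx.shape m n h]
    exact map_zero _
  d_comp_d' l m n _ _ := by
    ext x
    change (I.carrier n).mkQ (A.cx.d m n (A.cx.d l m x)) = 0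
    rw [d_apply_d_apply]
    exact map_zero _

/-- The quotient of a CDGA by a differential graded ideal. -/
def quotient : CDGA where
  cx := I.quotientComplex
  one := (I.carrier 0).mkQ A.one
  mul h := I.quotientMul h
  one_mul {i} x := by
    obtain ⟨x, rfl⟩ := (I.carrier i).mkQ_surjective x
    exact congrArg (I.carrier i).mkQ (A.one_mul x)
  mul_one {i} x := by
    obtain ⟨x, rfl⟩ := (I.carrier i).mkQ_surjective x
    exact congrArg (I.carrier i).mkQ (A.mul_one x)
  mul_assoc {i j k _ _ l} hij hjk h₁ h₂ x y z := by
    obtain ⟨x, rfl⟩ := (I.carrier i).mkQ_surjective x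
    obtain ⟨y, rfl⟩ := (I.carrier j).mkQ_surjective y
    obtain ⟨z, rfl⟩ := (I.carrier k).mkQ_surjective z
    exact congrArg (I.carrier l).mkQ (A.mul_assoc hij hjk h₁ h₂ x y z)
  mul_comm {i j k} h h' x y := by
    obtain ⟨x, rfl⟩ := (I.carrier i).mkQ_surjective x
    obtain ⟨y, rfl⟩ := (I.carrier j).mkQ_surjective y
    exact congrArg (I.carrier k).mkQ (A.mul_comm h h' x y)
  leibniz {i j k} h h₁ h₂ x y := by
    obtain ⟨x, rfl⟩ := (I.carrier i).mkQ_surjective x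
    obtain ⟨y, rfl⟩ := (I.carrier j).mkQ_surjective y
    exact congrArg (I.carrier (k + 1)).mkQ (A.leibniz h h₁ h₂ x y)

/-- The projection to the quotient. -/
def proj : A ⟶ I.quotient where
  hom :=
    { f := fun n => ModuleCat.ofHom (I.carrier n).mkQ
      comm' := fun _ _ _ => rfl }
  map_one := rfl
  map_mul _ _ _ := rfl

lemma proj_surjective (n : ℕ) : Function.Surjective (I.proj.hom.f n) :=
  (I.carrier n).mkQ_surjective

lemma proj_eq_zero {n : ℕ} {x : A.cx.X n} (hx : x ∈ I.carrier n) : I.proj.hom.f n x = 0 :=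
  (Submodule.Quotient.mk_eq_zero _).2 hx

variable {I}

lemma quotient_hom_ext {f g : I.quotient ⟶ B} (h : I.proj ≫ f = I.proj ≫ g) : f = g := by
  ext n x
  obtain ⟨x, rfl⟩ := I.proj_surjective n x
  exact congrArg (fun φ : A ⟶ B => φ.hom.f n x) h

/-- The map out of the quotient induced by a map killing the ideal. -/
def desc (f : A ⟶ B) (hf : ∀ n x, x ∈ I.carrier n → f.hom.f n x = 0) : I.quotient ⟶ B where
  hom :=
    { f := fun n => ModuleCat.ofHom ((I.carrier n).liftQ (f.hom.f n).hom (hf n))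
      comm' := fun m n _ => by
        ext x
        obtain ⟨x, rfl⟩ := I.proj_surjective m x
        exact (hom_comm_apply f.hom m n x).symm }
  map_one := f.map_one
  map_mul h x y := by
    obtain ⟨x, rfl⟩ := I.proj_surjective _ x
    obtain ⟨y, rfl⟩ := I.proj_surjective _ y
    exact f.map_mul h x y

lemma proj_desc (f : A ⟶ B) (hf : ∀ n x, x ∈ I.carrier n → f.hom.f n x = 0) :
    I.proj ≫ desc f hf = f := rfl

end DGIdeal

/-! ### General colimits of CDGAs -/

section Colimits

variable {J : Type} [Category.{0} J] (F : J ⥤ CDGA)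

/-- The free CDGA on the colimit of the underlying complexes of a diagram. -/
noncomputable abbrev colimitFree : CDGA := freeCDGA (colimit (F ⋙ forget))

/-- The canonical cochain map to the free CDGA on the colimit of the underlying complexes. -/
noncomputable def colimitFreeι (j : J) : (F.obj j).cx ⟶ (colimitFree F).cx :=
  colimit.ι (F ⋙ forget) j ≫ freeUnit _

/-- The relations to be imposed for the canonical maps to be morphisms of CDGAs. -/
inductive ColimitRel : ∀ n, (colimitFree F).cx.X n → Prop
  | one (j : J) : ColimitRel 0 ((colimitFreeι F j).f 0 (F.obj j).one - (colimitFree F).one)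
  | mul (j : J) {p q r : ℕ} (h : p + q = r) (x : (F.obj j).cx.X p) (y : (F.obj j).cx.X q) :
      ColimitRel r ((colimitFreeι F j).f r ((F.obj j).mul h x y) -
        (colimitFree F).mul h ((colimitFreeι F j).f p x) ((colimitFreeι F j).f q y))

/-- The ideal defining the colimit. -/
noncomputable abbrev colimitIdeal : DGIdeal (colimitFree F) := DGIdeal.span (ColimitRel F)

/-- The canonical maps to the colimit. -/
noncomputable def colimitι (j : J) : F.obj j ⟶ (colimitIdeal F).quotient where
  hom := colimitFreeι F j ≫ (colimitIdeal F).proj.hom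
  map_one := by
    have h := (colimitIdeal F).proj_eq_zero (DGIdeal.subset_span (ColimitRel.one j))
    rw [map_sub, sub_eq_zero] at h
    exact h
  map_mul h x y := by
    have h := (colimitIdeal F).proj_eq_zero (DGIdeal.subset_span (ColimitRel.mul j h x y))
    rw [map_sub, sub_eq_zero] at h
    exact h

/-- The colimit cocone. -/
noncomputable def colimitCocone : Cocone F where
  pt := (colimitIdeal F).quotient
  ι :=
    { app := colimitι F
      naturality := fun i j u => by
        apply hom_ext
        refine Eq.trans ?_ (Category.comp_id (colimitι F i).hom).symm
        change forget.map (F.map u) ≫ (colimit.ι (F ⋙ forget) j ≫ freeUnit _) ≫ _ =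
          (colimit.ι (F ⋙ forget) i ≫ freeUnit _) ≫ _
        rw [← colimit.w (F ⋙ forget) u, Functor.comp_map, Category.assoc, Category.assoc,
          Category.assoc] }

variable {F}

/-- The map from the free CDGA induced by a cocone. -/
noncomputable def colimitFreeDesc (s : Cocone F) : colimitFree F ⟶ s.pt :=
  freeLift (colimit.desc (F ⋙ forget) (forget.mapCocone s))

lemma colimitFreeι_desc (s : Cocone F) (j : J) :
    colimitFreeι F j ≫ (colimitFreeDesc s).hom = (s.ι.app j).hom := by
  refine (Category.assoc _ _ _).trans ?_
  refine (congrArg _ (freeUnit_freeLift _)).trans ?_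
  exact colimit.ι_desc (forget.mapCocone s) j

/-- The relations express that the legs into the free CDGA are unital and multiplicative, and the
legs of `s` are so already. -/
lemma colimitFreeDesc_rel (s : Cocone F) (n : ℕ) (x : (colimitFree F).cx.X n)
    (hx : ColimitRel F n x) : (colimitFreeDesc s).hom.f n x = 0 := by
  have e (j : J) (m : ℕ) (y : (F.obj j).cx.X m) :
      (colimitFreeDesc s).hom.f m ((colimitFreeι F j).f m y) = (s.ι.app j).hom.f m y := by
    rw [← colimitFreeι_desc]
    rfl
  cases hx with
  | one j =>
    rw [map_sub, e, (s.ι.app j).map_one, (colimitFreeDesc s).map_one]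
    exact sub_self s.pt.one
  | mul j h x y =>
    rw [map_sub, (colimitFreeDesc s).map_mul, e, e, e, (s.ι.app j).map_mul]
    exact sub_self (s.pt.mul h _ _)

/-- The colimit cocone is a colimit. -/
noncomputable def colimitCoconeIsColimit : IsColimit (colimitCocone F) where
  desc s := DGIdeal.desc (colimitFreeDesc s) fun n x hx =>
    DGIdeal.span_le_ker _ (colimitFreeDesc_rel s) hx
  fac s j := hom_ext (colimitFreeι_desc s j)
  uniq s m hm := by
    apply DGIdeal.quotient_hom_ext
    rw [DGIdeal.proj_desc]
    apply (freeHomEquiv _ _).injective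
    apply colimit.hom_ext
    intro j
    exact (congrArg Hom.hom (hm j)).trans (colimitFreeι_desc s j).symm

instance : HasColimitsOfSize.{0, 0} CDGA :=
  ⟨fun _ _ => ⟨fun _ => ⟨⟨⟨_, colimitCoconeIsColimit⟩⟩⟩⟩⟩

end Colimits

/-! ### Filtered colimits are computed on underlying complexes -/

section FilteredColimits

variable {J : Type} [Category.{0} J] (F : J ⥤ CDGA)

/-- The colimit of the underlying complexes of a diagram of CDGAs. -/
noncomputable abbrev filtColim : Ch := colimit (F ⋙ forget)

/-- The canonical maps to the colimit of the underlying complexes. -/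
noncomputable def filtι (j : J) : (F.obj j).cx ⟶ filtColim F := colimit.ι (F ⋙ forget) j

lemma filtι_map {i j : J} (u : i ⟶ j) {n : ℕ} (x : (F.obj i).cx.X n) :
    (filtι F j).f n ((F.map u).hom.f n x) = (filtι F i).f n x := by
  have h := colimit.w (F ⋙ forget) u
  exact congrArg (fun φ : (F.obj i).cx ⟶ filtColim F => φ.f n x) h

/-- The degree `n` part of the colimit is the colimit of the degree `n` parts. -/
noncomputable def filtEvalIsColimit (n : ℕ) :
    IsColimit ((HomologicalComplex.eval (ModuleCat.{0} ℚ) (ComplexShape.up ℕ) n).mapCocone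
      (colimit.cocone (F ⋙ forget))) :=
  isColimitOfPreserves _ (colimit.isColimit _)

variable [IsFiltered J]

/-- Evaluation in a degree preserves colimits, and a filtered colimit of modules is computed on
underlying sets. Hence finitely many elements have representatives at a common stage, and equality
holds at some stage. -/
lemma filt_exists_rep {n : ℕ} (x : (filtColim F).X n) :
    ∃ (j : J) (x' : (F.obj j).cx.X n), (filtι F j).f n x' = x :=
  Concrete.isColimit_exists_rep _ (filtEvalIsColimit F n) x

lemma filt_exists_eq {n : ℕ} {i j : J} (x : (F.obj i).cx.X n) (y : (F.obj j).cx.X n)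
    (h : (filtι F i).f n x = (filtι F j).f n y) :
    ∃ (k : J) (u : i ⟶ k) (v : j ⟶ k), (F.map u).hom.f n x = (F.map v).hom.f n y :=
  Concrete.isColimit_exists_of_rep_eq _ (filtEvalIsColimit F n) x y h

lemma filt_exists_rep₂ {m n : ℕ} (x : (filtColim F).X m) (y : (filtColim F).X n) :
    ∃ (j : J) (x' : (F.obj j).cx.X m) (y' : (F.obj j).cx.X n),
      (filtι F j).f m x' = x ∧ (filtι F j).f n y' = y := by
  obtain ⟨i, x, rfl⟩ := filt_exists_rep F x
  obtain ⟨j, y, rfl⟩ := filt_exists_rep F y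
  exact ⟨IsFiltered.max i j, (F.map (IsFiltered.leftToMax i j)).hom.f m x,
    (F.map (IsFiltered.rightToMax i j)).hom.f n y, filtι_map F _ _, filtι_map F _ _⟩

lemma filt_exists_rep₃ {l m n : ℕ} (x : (filtColim F).X l) (y : (filtColim F).X m)
    (z : (filtColim F).X n) :
    ∃ (j : J) (x' : (F.obj j).cx.X l) (y' : (F.obj j).cx.X m) (z' : (F.obj j).cx.X n),
      (filtι F j).f l x' = x ∧ (filtι F j).f m y' = y ∧ (filtι F j).f n z' = z := by
  obtain ⟨i, x, y, rfl, rfl⟩ := filt_exists_rep₂ F x y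
  obtain ⟨j, z, rfl⟩ := filt_exists_rep F z
  exact ⟨IsFiltered.max i j, (F.map (IsFiltered.leftToMax i j)).hom.f l x,
    (F.map (IsFiltered.leftToMax i j)).hom.f m y,
    (F.map (IsFiltered.rightToMax i j)).hom.f n z,
    filtι_map F _ _, filtι_map F _ _, filtι_map F _ _⟩

/-- This is the independence of representatives needed to multiply in the colimit. -/
lemma filtι_mul_eq {p q r : ℕ} (h : p + q = r) {i j : J} (x : (F.obj i).cx.X p)
    (y : (F.obj i).cx.X q) (x' : (F.obj j).cx.X p) (y' : (F.obj j).cx.X q)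
    (hx : (filtι F i).f p x = (filtι F j).f p x') (hy : (filtι F i).f q y = (filtι F j).f q y') :
    (filtι F i).f r ((F.obj i).mul h x y) = (filtι F j).f r ((F.obj j).mul h x' y') := by
  obtain ⟨k, u, v, huv⟩ := filt_exists_eq F x x' hx
  obtain ⟨l, u', v', huv'⟩ := filt_exists_eq F y y' hy
  -- The equalities for `x` and `y` hold at possibly different stages `k` and `l`; the bowtie merges
  -- these compatibly with the arrows from both `i` and `j`.
  obtain ⟨m, a, b, h₁, h₂⟩ := IsFiltered.bowtie u u' v v'
  have hx : (F.map (u ≫ a)).hom.f p x = (F.map (v ≫ a)).hom.f p x' := by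
    rw [F.map_comp, F.map_comp]
    exact congrArg ((F.map a).hom.f p) huv
  have hy : (F.map (u ≫ a)).hom.f q y = (F.map (v ≫ a)).hom.f q y' := by
    rw [h₁, h₂, F.map_comp, F.map_comp]
    exact congrArg ((F.map b).hom.f q) huv'
  rw [← filtι_map F (u ≫ a), ← filtι_map F (v ≫ a), (F.map _).map_mul, (F.map _).map_mul, hx, hy]

/-- The product of two elements of a filtered colimit, computed by representatives. -/
noncomputable def filtMulFun {p q r : ℕ} (h : p + q = r) (x : (filtColim F).X p)
    (y : (filtColim F).X q) : (filtColim F).X r :=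
  (filtι F (filt_exists_rep₂ F x y).choose).f r
    ((F.obj _).mul h (filt_exists_rep₂ F x y).choose_spec.choose
      (filt_exists_rep₂ F x y).choose_spec.choose_spec.choose)

lemma filtMulFun_ι {p q r : ℕ} (h : p + q = r) {j : J} (x : (F.obj j).cx.X p)
    (y : (F.obj j).cx.X q) :
    filtMulFun F h ((filtι F j).f p x) ((filtι F j).f q y) =
      (filtι F j).f r ((F.obj j).mul h x y) := by
  have hs := (filt_exists_rep₂ F ((filtι F j).f p x)
    ((filtι F j).f q y)).choose_spec.choose_spec.choose_spec
  exact filtι_mul_eq F h _ _ _ _ hs.1 hs.2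

/-- The multiplication on a filtered colimit of CDGAs. -/
noncomputable def filtMul {p q r : ℕ} (h : p + q = r) :
    (filtColim F).X p →ₗ[ℚ] (filtColim F).X q →ₗ[ℚ] (filtColim F).X r :=
  LinearMap.mk₂ ℚ (filtMulFun F h)
    (fun x x' y => by
      obtain ⟨j, x, x', y, rfl, rfl, rfl⟩ := filt_exists_rep₃ F x x' y
      rw [← map_add, filtMulFun_ι, filtMulFun_ι, filtMulFun_ι, ← map_add, LinearMap.map_add₂])
    (fun c x y => by
      obtain ⟨j, x, y, rfl, rfl⟩ := filt_exists_rep₂ F x y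
      rw [← map_smul, filtMulFun_ι, filtMulFun_ι, ← map_smul, LinearMap.map_smul₂])
    (fun x y y' => by
      obtain ⟨j, x, y, y', rfl, rfl, rfl⟩ := filt_exists_rep₃ F x y y'
      rw [← map_add, filtMulFun_ι, filtMulFun_ι, filtMulFun_ι, ← map_add, map_add])
    (fun c x y => by
      obtain ⟨j, x, y, rfl, rfl⟩ := filt_exists_rep₂ F x y
      rw [← map_smul, filtMulFun_ι, filtMulFun_ι, ← map_smul, map_smul])

lemma filtMul_ι {p q r : ℕ} (h : p + q = r) {j : J} (x : (F.obj j).cx.X p)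
    (y : (F.obj j).cx.X q) :
    filtMul F h ((filtι F j).f p x) ((filtι F j).f q y) =
      (filtι F j).f r ((F.obj j).mul h x y) :=
  filtMulFun_ι F h x y

/-- The unit of a filtered colimit of CDGAs. -/
noncomputable def filtOne : (filtColim F).X 0 :=
  (filtι F (IsFiltered.nonempty (C := J)).some).f 0 (F.obj _).one

lemma filtι_one (j : J) : (filtι F j).f 0 (F.obj j).one = filtOne F := by
  let i := (IsFiltered.nonempty (C := J)).some
  change _ = (filtι F i).f 0 (F.obj i).one
  rw [← filtι_map F (IsFiltered.leftToMax i j), ← filtι_map F (IsFiltered.rightToMax i j),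
    (F.map _).map_one, (F.map _).map_one]

/-- The CDGA structure on the filtered colimit of the underlying complexes. -/
noncomputable def filtCDGA : CDGA where
  cx := filtColim F
  one := filtOne F
  mul h := filtMul F h
  one_mul x := by
    obtain ⟨j, x, rfl⟩ := filt_exists_rep F x
    rw [← filtι_one F j, filtMul_ι, (F.obj j).one_mul]
  mul_one x := by
    obtain ⟨j, x, rfl⟩ := filt_exists_rep F x
    rw [← filtι_one F j, filtMul_ι, (F.obj j).mul_one]
  mul_assoc hij hjk h₁ h₂ x y z := by
    obtain ⟨j, x, y, z, rfl, rfl, rfl⟩ := filt_exists_rep₃ F x y z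
    rw [filtMul_ι, filtMul_ι, filtMul_ι, filtMul_ι, (F.obj j).mul_assoc hij hjk h₁ h₂]
  mul_comm h h' x y := by
    obtain ⟨j, x, y, rfl, rfl⟩ := filt_exists_rep₂ F x y
    rw [filtMul_ι, filtMul_ι, (F.obj j).mul_comm h h', map_smul]
  leibniz h h₁ h₂ x y := by
    obtain ⟨j, x, y, rfl, rfl⟩ := filt_exists_rep₂ F x y
    rw [filtMul_ι, ← hom_comm_apply, (F.obj j).leibniz h h₁ h₂, ← hom_comm_apply,
      ← hom_comm_apply, filtMul_ι, filtMul_ι, map_add, map_smul]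

/-- The cocone given by the CDGA structure on the filtered colimit. -/
noncomputable def filtCocone : Cocone F where
  pt := filtCDGA F
  ι :=
    { app := fun j =>
        { hom := filtι F j
          map_one := filtι_one F j
          map_mul := fun h x y => (filtMul_ι F h x y).symm }
      naturality := fun i j u => by
        ext n x
        exact filtι_map F u x }

/-- The cocone given by the CDGA structure on the filtered colimit is a colimit. -/
noncomputable def filtCoconeIsColimit : IsColimit (filtCocone F) where
  desc s :=
    have e (j : J) {n : ℕ} (x : (F.obj j).cx.X n) :
        (colimit.desc (F ⋙ forget) (forget.mapCocone s)).f n ((filtι F j).f n x) =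
          (s.ι.app j).hom.f n x :=
      congrArg (fun φ : (F.obj j).cx ⟶ s.pt.cx => φ.f n x)
        (colimit.ι_desc (forget.mapCocone s) j)
    { hom := colimit.desc (F ⋙ forget) (forget.mapCocone s)
      map_one := (e _ _).trans (s.ι.app _).map_one
      map_mul := fun {p q r} h x y => by
        obtain ⟨j, x, y, rfl, rfl⟩ := filt_exists_rep₂ F x y
        refine (congrArg _ (filtMul_ι F h x y)).trans ?_
        refine (e _ _).trans (((s.ι.app j).map_mul h x y).trans ?_)
        exact (congrArg₂ (fun a b => s.pt.mul h a b) (e j x) (e j y)).symm }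
  fac s j := hom_ext (colimit.ι_desc (forget.mapCocone s) j)
  uniq s m hm := by
    apply hom_ext
    apply colimit.hom_ext
    intro j
    exact (congrArg Hom.hom (hm j)).trans (colimit.ι_desc (forget.mapCocone s) j).symm

/-- The underlying complex of the colimit just constructed is the colimit of complexes by
definition. Finite presentability of the generators rests on this. -/
instance : PreservesColimitsOfShape J forget where
  preservesColimit {F} :=
    preservesColimit_of_preserves_colimit_cocone (filtCoconeIsColimit F)
      (colimit.isColimit (F ⋙ forget))

end FilteredColimits

end CDGA

/-- The inverse cochain map is automatically multiplicative and unital, as one checks after applying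
the injective map `f`. -/
lemma CDGA.isIso_of_isIso_hom {A B : CDGA} (f : A ⟶ B) [IsIso f.hom] : IsIso f := by
  have e (n : ℕ) (x : B.cx.X n) : f.hom.f n ((inv f.hom).f n x) = x :=
    congrArg (fun φ : B.cx ⟶ B.cx => φ.f n x) (IsIso.inv_hom_id f.hom)
  have inj (n : ℕ) : Function.Injective (f.hom.f n) :=
    ((ConcreteCategory.isIso_iff_bijective (f.hom.f n)).1 inferInstance).1
  refine ⟨⟨{ hom := inv f.hom, map_one := ?_, map_mul := fun h x y => ?_ }, ?_, ?_⟩⟩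
  · exact inj 0 ((e _ _).trans f.map_one.symm)
  · apply inj
    rw [e, f.map_mul, e, e]
  · exact CDGA.hom_ext (IsIso.hom_inv_id f.hom)
  · exact CDGA.hom_ext (IsIso.inv_hom_id f.hom)

lemma CDGA.isIso_of_bijective {A B : CDGA} (f : A ⟶ B)
    (hf : ∀ n, Function.Bijective (f.hom.f n)) : IsIso f := by
  have (n : ℕ) : IsIso (f.hom.f n) := (ConcreteCategory.isIso_iff_bijective _).2 (hf n)
  have : IsIso f.hom := HomologicalComplex.Hom.isIso_of_components f.hom
  exact isIso_of_isIso_hom f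

/-! ### Finitely presentable generators and local presentability -/

section Generators

/-- The functor sending a persistent CDGA to its degree `k` part at time `s`. -/
noncomputable abbrev evalAt (s : ℝ≥0) (k : ℕ) : PCDGA ⥤ Type :=
  pForget ⋙ (evaluation ℝ≥0 Ch).obj s ⋙
    HomologicalComplex.eval (ModuleCat.{0} ℚ) (ComplexShape.up ℕ) k ⋙ forget (ModuleCat.{0} ℚ)

/-- The object of persistent CDGAs corepresenting the degree `k` part at time `s`. -/
noncomputable abbrev freeDisk (s : ℝ≥0) (k : ℕ) : PCDGA := pFree.obj (pDisk s (k + 1))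

/-- Maps out of `Λ𝔻^{k+1}_s` are elements of degree `k` at time `s`. -/
noncomputable def freeDiskEquiv (s : ℝ≥0) (k : ℕ) (X : PCDGA) :
    (freeDisk s k ⟶ X) ≃ (X.obj s).cx.X k :=
  (pFreeAdj.homEquiv _ X).trans (pDiskEquiv (pForget.obj X) s k)

lemma freeDiskEquiv_comp {s : ℝ≥0} {k : ℕ} {X Y : PCDGA} (φ : freeDisk s k ⟶ X) (f : X ⟶ Y) :
    freeDiskEquiv s k Y (φ ≫ f) = (f.app s).hom.f k (freeDiskEquiv s k X φ) := by
  exact congrArg (pDiskEquiv (pForget.obj Y) s k)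
    (pFreeAdj.homEquiv_naturality_right φ f)

/-- The object `Λ𝔻^{k+1}_s` corepresents the degree `k` part at time `s`. -/
noncomputable def freeDiskIso (s : ℝ≥0) (k : ℕ) :
    evalAt s k ≅ coyoneda.obj (Opposite.op (freeDisk s k)) :=
  NatIso.ofComponents (fun X => (freeDiskEquiv s k X).symm.toIso) fun {X Y} f => by
    ext x
    apply (freeDiskEquiv s k Y).injective
    refine (Equiv.apply_symm_apply _ _).trans ?_
    refine Eq.trans ?_ (freeDiskEquiv_comp _ f).symm
    exact congrArg ((f.app s).hom.f k) (Equiv.apply_symm_apply (freeDiskEquiv s k X) x).symm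

attribute [local instance] Cardinal.fact_isRegular_aleph0

/-- The corepresented functor takes the degree `k` part at time `s`, a composite of functors that
preserve filtered colimits. -/
instance (s : ℝ≥0) (k : ℕ) : IsCardinalPresentable (freeDisk s k) Cardinal.aleph0.{0} := by
  have : (evalAt s k).IsCardinalAccessible Cardinal.aleph0.{0} :=
    { preservesColimitOfShape := fun J _ hJ => by
        have : IsFiltered J := isFiltered_of_isCardinalFiltered J Cardinal.aleph0.{0}
        infer_instance }
  exact Functor.isCardinalAccessible_of_natIso (freeDiskIso s k) _

/-- The set of objects `Λ𝔻^{k+1}_s`. -/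
noncomputable def freeDisks : ObjectProperty PCDGA :=
  ObjectProperty.ofObj fun p : ℝ≥0 × ℕ => freeDisk p.1 p.2

instance : ObjectProperty.Small.{0} freeDisks := by
  unfold freeDisks
  infer_instance

/-- Maps out of the generators are the elements in all degrees and times. So they separate
morphisms, and a monomorphism through which they all lift is bijective on elements. -/
lemma freeDisks_isStrongGenerator : freeDisks.IsStrongGenerator := by
  rw [ObjectProperty.isStrongGenerator_iff]
  constructor
  · intro X Y f g h
    ext s n x
    have e := h (freeDisk s n) ⟨(s, n)⟩ ((freeDiskEquiv s n X).symm x)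
    replace e := congrArg (freeDiskEquiv s n Y) e
    rw [freeDiskEquiv_comp, freeDiskEquiv_comp, Equiv.apply_symm_apply] at e
    exact e
  · intro X Y i _ h
    have (s : ℝ≥0) : IsIso (i.app s) := by
      refine CDGA.isIso_of_bijective _ fun n => ⟨fun x y hxy => ?_, fun y => ?_⟩
      · apply (freeDiskEquiv s n X).symm.injective
        rw [← cancel_mono i]
        apply (freeDiskEquiv s n Y).injective
        rw [freeDiskEquiv_comp, freeDiskEquiv_comp, Equiv.apply_symm_apply,
          Equiv.apply_symm_apply, hxy]
      · obtain ⟨φ, hφ⟩ := h (freeDisk s n) ⟨(s, n)⟩ ((freeDiskEquiv s n Y).symm y)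
        refine ⟨freeDiskEquiv s n X φ, ?_⟩
        rw [← freeDiskEquiv_comp, Equiv.eq_symm_apply] at *
        exact hφ
    exact NatIso.isIso_of_isIso_app i

instance : HasColimitsOfSize.{0, 0} PCDGA := inferInstance

instance : HasLimitsOfSize.{0, 0} PCDGA := inferInstance

instance : IsLocallyPresentable.{0} PCDGA where
  exists_cardinal := ⟨Cardinal.aleph0, inferInstance,
    (IsCardinalLocallyPresentable.iff_exists_isStrongGenerator _ _).2
      ⟨freeDisks, inferInstance, freeDisks_isStrongGenerator, by
        rintro _ ⟨p⟩
        exact inferInstanceAs (IsCardinalPresentable (freeDisk p.1 p.2) _)⟩⟩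

end Generators

/-! ### The small object argument in a locally presentable category -/

section SmallObjectArgument

universe v u

/-- In a locally presentable category, any small class of morphisms permits the small object
argument. -/
lemma hasSmallObjectArgument_of_isSmall {C : Type u} [Category.{v} C] [IsLocallyPresentable.{v} C]
    [HasColimitsOfSize.{v, v} C] (I : MorphismProperty C) [hI : MorphismProperty.IsSmall.{v} I] :
    MorphismProperty.HasSmallObjectArgument.{v} I := by
  obtain ⟨ι, A, B, f, rfl⟩ := (MorphismProperty.isSmall_iff_eq_ofHoms.{v} I).1 hI
  have h (i : ι) : IsPresentable.{v} (A i) := inferInstance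
  choose c hc hA using fun i => (h i).exists_cardinal
  -- One regular `κ` above the presentability ranks of all the sources, available because the family
  -- is small.
  obtain ⟨κ, hκ, hlt⟩ := HasCardinalLT.exists_regular_cardinal_forall.{v}
    fun i => (c i).ord.ToType
  have : Fact κ.IsRegular := ⟨hκ⟩
  have : Nonempty κ.ord.ToType := by simpa using hκ.ne_zero
  have := WellFoundedLT.toOrderBot κ.ord.ToType
  refine ⟨κ, inferInstance, inferInstance, ?_⟩
  have : HasPushouts C := inferInstance
  exact
    { preservesColimit := by
        rintro _ _ _ _ _ ⟨i⟩ g hg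
        have hle : c i ≤ κ := le_of_lt (by
          simpa [hasCardinalLT_iff_cardinal_mk_lt] using hlt i)
        have := (coyoneda.obj (Opposite.op (A i))).isCardinalAccessible_of_le hle
        have := preservesColimitsOfShape_of_isCardinalPresentable (A i) κ κ.ord.ToType
        infer_instance }

end SmallObjectArgument

/-! ### Smallness of `Λ𝕀` and `Λ𝕁`, and transposed lifting problems -/

section SmallSets

instance : MorphismProperty.IsSmall.{0} setΛI where
  small_toSet := by
    let φ : (ℕ × {q : ℝ≥0 × ℝ≥0 // q.1 < q.2}) ⊕ (ℕ × ℝ≥0) → setΛI.toSet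
      | .inl p => ⟨Arrow.mk (pFree.map (pSphereToDisk p.2.2 p.1)), ⟨.fin p.1 p.2.2⟩⟩
      | .inr p => ⟨Arrow.mk (pFree.map (pSphereInfToDisk p.2 p.1)), ⟨.inf p.1 p.2⟩⟩
    refine small_of_surjective (f := φ) ?_
    rintro ⟨⟨_, _, _⟩, ⟨⟨k, h⟩ | ⟨k, s⟩⟩⟩
    · exact ⟨.inl (k, ⟨(_, _), h⟩), rfl⟩
    · exact ⟨.inr (k, s), rfl⟩

instance : MorphismProperty.IsSmall.{0} setΛJ where
  small_toSet := by
    let φ : (ℕ × {q : ℝ≥0 × ℝ≥0 // q.1 < q.2}) ⊕ (ℕ × ℝ≥0) → setΛJ.toSet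
      | .inl p => ⟨Arrow.mk (pFree.map (pDiskToDisk p.2.2 p.1)), ⟨.fin p.1 p.2.2⟩⟩
      | .inr p => ⟨Arrow.mk (pFree.map (0 : (0 : PCh) ⟶ pDisk p.2 p.1)), ⟨.inf p.1 p.2⟩⟩
    refine small_of_surjective (f := φ) ?_
    rintro ⟨⟨_, _, _⟩, ⟨⟨k, h⟩ | ⟨k, s⟩⟩⟩
    · exact ⟨.inl (k, ⟨(_, _), h⟩), rfl⟩
    · exact ⟨.inr (k, s), rfl⟩

instance : MorphismProperty.HasSmallObjectArgument.{0} setΛI :=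
  hasSmallObjectArgument_of_isSmall setΛI

instance : MorphismProperty.HasSmallObjectArgument.{0} setΛJ :=
  hasSmallObjectArgument_of_isSmall setΛJ

/-- Lifting problems transpose along `Λ ⊣ U`; likewise for `𝕁` below. -/
lemma setΛI_rlp_iff {X Y : PCDGA} (f : X ⟶ Y) : setΛI.rlp f ↔ setI.rlp (pForget.map f) := by
  constructor
  · intro hf _ _ i hi
    exact (pFreeAdj.hasLiftingProperty_iff i f).1 (hf _ ⟨hi⟩)
  · rintro hf _ _ _ ⟨hi⟩
    exact (pFreeAdj.hasLiftingProperty_iff _ f).2 (hf _ hi)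

lemma setΛJ_rlp_iff {X Y : PCDGA} (f : X ⟶ Y) : setΛJ.rlp f ↔ setJ.rlp (pForget.map f) := by
  constructor
  · intro hf _ _ i hi
    exact (pFreeAdj.hasLiftingProperty_iff i f).1 (hf _ ⟨hi⟩)
  · rintro hf _ _ _ ⟨hi⟩
    exact (pFreeAdj.hasLiftingProperty_iff _ f).2 (hf _ hi)

end SmallSets

namespace CDGA

open scoped Polynomial TensorProduct

/-! ### Polynomials over a CDGA, their derivative and integral -/

section Polynomials

variable (B : CDGA)

/-- The multiplication of polynomials with coefficients in a CDGA. -/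
noncomputable def polyMul {i j k : ℕ} (h : i + j = k) :
    (B.cx.X i ⊗[ℚ] ℚ[X]) →ₗ[ℚ] (B.cx.X j ⊗[ℚ] ℚ[X]) →ₗ[ℚ] (B.cx.X k ⊗[ℚ] ℚ[X]) :=
  TensorProduct.map₂ (B.mul h) (LinearMap.mul ℚ ℚ[X])

@[simp]
lemma polyMul_tmul {i j k : ℕ} (h : i + j = k) (x : B.cx.X i) (p : ℚ[X]) (y : B.cx.X j)
    (q : ℚ[X]) : polyMul B h (x ⊗ₜ p) (y ⊗ₜ q) = B.mul h x y ⊗ₜ (p * q) := rfl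

lemma polyMul_one_left {i : ℕ} (x : B.cx.X i ⊗[ℚ] ℚ[X]) :
    polyMul B (Nat.zero_add i) (B.one ⊗ₜ 1) x = x := by
  induction x using TensorProduct.induction_on with
  | zero => exact map_zero _
  | tmul x p => rw [polyMul_tmul, B.one_mul, _root_.one_mul]
  | add x y hx hy => rw [map_add, hx, hy]

lemma polyMul_assoc {i j k ij jk l : ℕ} (hij : i + j = ij) (hjk : j + k = jk)
    (h₁ : ij + k = l) (h₂ : i + jk = l) (x : B.cx.X i ⊗[ℚ] ℚ[X]) (y : B.cx.X j ⊗[ℚ] ℚ[X])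
    (z : B.cx.X k ⊗[ℚ] ℚ[X]) :
    polyMul B h₁ (polyMul B hij x y) z = polyMul B h₂ x (polyMul B hjk y z) := by
  induction x using TensorProduct.induction_on with
  | zero => simp only [map_zero, LinearMap.zero_apply]
  | add x x' hx hx' => simp only [map_add, LinearMap.add_apply, hx, hx']
  | tmul x p =>
    induction y using TensorProduct.induction_on with
    | zero => simp only [map_zero, LinearMap.zero_apply]
    | add y y' hy hy' => simp only [map_add, LinearMap.add_apply, hy, hy']
    | tmul y q =>
      induction z using TensorProduct.induction_on with
      | zero => simp only [map_zero]
      | add z z' hz hz' => simp only [map_add, hz, hz']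
      | tmul z r =>
        simp only [polyMul_tmul]
        rw [B.mul_assoc hij hjk h₁ h₂, _root_.mul_assoc]

/-- The polynomial variable has degree `0`, so no signs arise beyond those of `B`. -/
lemma polyMul_comm {i j k : ℕ} (h : i + j = k) (h' : j + i = k) (x : B.cx.X i ⊗[ℚ] ℚ[X])
    (y : B.cx.X j ⊗[ℚ] ℚ[X]) :
    polyMul B h x y = ((-1 : ℚ) ^ (i * j)) • polyMul B h' y x := by
  induction x using TensorProduct.induction_on with
  | zero => simp only [map_zero, LinearMap.zero_apply, smul_zero]
  | add x x' hx hx' => simp only [map_add, LinearMap.add_apply, hx, hx', smul_add]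
  | tmul x p =>
    induction y using TensorProduct.induction_on with
    | zero => simp only [map_zero, LinearMap.zero_apply, smul_zero]
    | add y y' hy hy' => simp only [map_add, LinearMap.add_apply, hy, hy', smul_add]
    | tmul y q =>
      rw [polyMul_tmul, polyMul_tmul, B.mul_comm h h', _root_.mul_comm p q,
        TensorProduct.smul_tmul']

lemma polyMul_one_right {i : ℕ} (x : B.cx.X i ⊗[ℚ] ℚ[X]) :
    polyMul B (Nat.add_zero i) x (B.one ⊗ₜ 1) = x := by
  rw [polyMul_comm B _ (Nat.zero_add i), polyMul_one_left, Nat.mul_zero, pow_zero, one_smul]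

/-- The differential of polynomials, acting on coefficients. -/
noncomputable def polyD (K : Ch) (m n : ℕ) : (K.X m ⊗[ℚ] ℚ[X]) →ₗ[ℚ] (K.X n ⊗[ℚ] ℚ[X]) :=
  (K.d m n).hom.rTensor ℚ[X]

@[simp]
lemma polyD_tmul (K : Ch) (m n : ℕ) (x : K.X m) (p : ℚ[X]) :
    polyD K m n (x ⊗ₜ p) = K.d m n x ⊗ₜ p := rfl

lemma polyD_polyMul {i j k : ℕ} (h : i + j = k) (h₁ : (i + 1) + j = k + 1)
    (h₂ : i + (j + 1) = k + 1) (x : B.cx.X i ⊗[ℚ] ℚ[X]) (y : B.cx.X j ⊗[ℚ] ℚ[X]) :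
    polyD B.cx k (k + 1) (polyMul B h x y) =
      polyMul B h₁ (polyD B.cx i (i + 1) x) y +
        ((-1 : ℚ) ^ i) • polyMul B h₂ x (polyD B.cx j (j + 1) y) := by
  induction x using TensorProduct.induction_on with
  | zero => simp only [map_zero, LinearMap.zero_apply, smul_zero, add_zero]
  | add x x' hx hx' =>
    simp only [map_add, LinearMap.add_apply, hx, hx', smul_add]
    abel
  | tmul x p =>
    induction y using TensorProduct.induction_on with
    | zero => simp only [map_zero, smul_zero, add_zero]
    | add y y' hy hy' =>
      simp only [map_add, hy, hy', smul_add]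
      abel
    | tmul y q =>
      rw [polyMul_tmul, polyD_tmul, polyD_tmul, polyD_tmul, polyMul_tmul, polyMul_tmul,
        B.leibniz h h₁ h₂, TensorProduct.add_tmul, TensorProduct.smul_tmul']

/-- The complex of polynomials with coefficients in a cochain complex. -/
noncomputable def polyComplex (K : Ch) : Ch where
  X n := ModuleCat.of ℚ (K.X n ⊗[ℚ] ℚ[X])
  d m n := ModuleCat.ofHom (polyD K m n)
  shape m n h := by
    ext1
    change (K.d m n).hom.rTensor ℚ[X] = 0
    rw [K.shape m n h]
    exact LinearMap.rTensor_zero _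
  d_comp_d' l m n _ _ := by
    ext1
    refine (LinearMap.rTensor_comp _ _ _).symm.trans ?_
    rw [← ModuleCat.hom_comp, K.d_comp_d]
    exact LinearMap.rTensor_zero _

/-- The CDGA of polynomials in one variable of degree zero with coefficients in a CDGA,
where the differential acts on coefficients only. -/
noncomputable def poly : CDGA where
  cx := polyComplex B.cx
  one := (B.one ⊗ₜ[ℚ] (1 : ℚ[X]) : B.cx.X 0 ⊗[ℚ] ℚ[X])
  mul h := polyMul B h
  one_mul x := polyMul_one_left B x
  mul_one x := polyMul_one_right B x
  mul_assoc hij hjk h₁ h₂ x y z := polyMul_assoc B hij hjk h₁ h₂ x y z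
  mul_comm h h' x y := polyMul_comm B h h' x y
  leibniz h h₁ h₂ x y := polyD_polyMul B h h₁ h₂ x y

/-- The inclusion of the coefficients. -/
noncomputable def polyC : B ⟶ poly B where
  hom :=
    { f := fun n => ModuleCat.ofHom ((TensorProduct.mk ℚ (B.cx.X n) ℚ[X]).flip 1)
      comm' := fun _ _ _ => rfl }
  map_one := rfl
  map_mul h x y := by
    change B.mul h x y ⊗ₜ[ℚ] (1 : ℚ[X]) = polyMul B h (x ⊗ₜ 1) (y ⊗ₜ 1)
    rw [polyMul_tmul, _root_.mul_one]

/-- Contraction of polynomials with coefficients in a module along a linear form. -/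
noncomputable def contract (M : Type) [AddCommGroup M] [Module ℚ M] (φ : ℚ[X] →ₗ[ℚ] ℚ) :
    (M ⊗[ℚ] ℚ[X]) →ₗ[ℚ] M :=
  (TensorProduct.rid ℚ M).toLinearMap ∘ₗ φ.lTensor M

lemma contract_tmul {M : Type} [AddCommGroup M] [Module ℚ M] (φ : ℚ[X] →ₗ[ℚ] ℚ) (x : M)
    (p : ℚ[X]) : contract M φ (x ⊗ₜ p) = φ p • x := rfl

lemma d_contract (K : Ch) (φ : ℚ[X] →ₗ[ℚ] ℚ) (m n : ℕ) (x : K.X m ⊗[ℚ] ℚ[X]) :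
    K.d m n (contract (K.X m) φ x) = contract (K.X n) φ (polyD K m n x) := by
  induction x using TensorProduct.induction_on with
  | zero => simp only [map_zero]
  | tmul x p => rw [polyD_tmul, contract_tmul, contract_tmul, map_smul]
  | add x y hx hy => simp only [map_add, hx, hy]

/-- Contraction serves both for evaluation, where multiplicativity holds, and for integration, which
is only linear; hence the hypothesis on `φ`. -/
lemma contract_polyMul (φ : ℚ[X] →ₗ[ℚ] ℚ) (hφ : ∀ p q, φ (p * q) = φ p * φ q) {i j k : ℕ}
    (h : i + j = k) (x : B.cx.X i ⊗[ℚ] ℚ[X]) (y : B.cx.X j ⊗[ℚ] ℚ[X]) :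
    contract (B.cx.X k) φ (polyMul B h x y) =
      B.mul h (contract (B.cx.X i) φ x) (contract (B.cx.X j) φ y) := by
  induction x using TensorProduct.induction_on with
  | zero => simp only [map_zero, LinearMap.zero_apply]
  | add x x' hx hx' => simp only [map_add, LinearMap.add_apply, hx, hx']
  | tmul x p =>
    induction y using TensorProduct.induction_on with
    | zero => simp only [map_zero]
    | add y y' hy hy' => simp only [map_add, hy, hy']
    | tmul y q =>
      rw [polyMul_tmul, contract_tmul, contract_tmul, contract_tmul, hφ,
        LinearMap.map_smul₂, map_smul, smul_smul]

/-- Evaluation of polynomials at a scalar. -/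
noncomputable def polyEval (a : ℚ) : poly B ⟶ B where
  hom :=
    { f := fun n => ModuleCat.ofHom (contract (B.cx.X n) (Polynomial.leval a))
      comm' := fun m n _ => by
        ext1
        exact LinearMap.ext fun x => d_contract B.cx _ m n x }
  map_one := by
    refine (contract_tmul (Polynomial.leval a) B.one 1).trans ?_
    rw [Polynomial.leval_apply, Polynomial.eval_one, one_smul]
  map_mul h x y := contract_polyMul B (Polynomial.leval a) (fun p q => Polynomial.eval_mul) h x y

/-- A derivation of degree zero of a CDGA, commuting with the differential. -/
structure Der (T : CDGA) where
  /-- the underlying linear maps -/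
  map : ∀ n, T.cx.X n →ₗ[ℚ] T.cx.X n
  map_d : ∀ n (x : T.cx.X n), map (n + 1) (T.cx.d n (n + 1) x) = T.cx.d n (n + 1) (map n x)
  map_mul : ∀ {i j k : ℕ} (h : i + j = k) (x : T.cx.X i) (y : T.cx.X j),
    map k (T.mul h x y) = T.mul h (map i x) y + T.mul h x (map j y)

/-- The derivative of polynomials. -/
noncomputable def polyDeriv (M : Type) [AddCommGroup M] [Module ℚ M] :
    (M ⊗[ℚ] ℚ[X]) →ₗ[ℚ] (M ⊗[ℚ] ℚ[X]) :=
  Polynomial.derivative.lTensor M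

@[simp]
lemma polyDeriv_tmul {M : Type} [AddCommGroup M] [Module ℚ M] (x : M) (p : ℚ[X]) :
    polyDeriv M (x ⊗ₜ p) = x ⊗ₜ Polynomial.derivative p := rfl

lemma polyDeriv_polyD (K : Ch) (m n : ℕ) (x : K.X m ⊗[ℚ] ℚ[X]) :
    polyDeriv (K.X n) (polyD K m n x) = polyD K m n (polyDeriv (K.X m) x) := by
  induction x using TensorProduct.induction_on with
  | zero => simp only [map_zero]
  | tmul x p => rfl
  | add x y hx hy => simp only [map_add, hx, hy]

lemma polyDeriv_polyMul {i j k : ℕ} (h : i + j = k) (x : B.cx.X i ⊗[ℚ] ℚ[X])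
    (y : B.cx.X j ⊗[ℚ] ℚ[X]) :
    polyDeriv (B.cx.X k) (polyMul B h x y) =
      polyMul B h (polyDeriv (B.cx.X i) x) y + polyMul B h x (polyDeriv (B.cx.X j) y) := by
  induction x using TensorProduct.induction_on with
  | zero => simp only [map_zero, LinearMap.zero_apply, add_zero]
  | add x x' hx hx' =>
    simp only [map_add, LinearMap.add_apply, hx, hx']
    abel
  | tmul x p =>
    induction y using TensorProduct.induction_on with
    | zero => simp only [map_zero, add_zero]
    | add y y' hy hy' =>
      simp only [map_add, hy, hy']
      abel
    | tmul y q =>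
      rw [polyMul_tmul, polyDeriv_tmul, polyDeriv_tmul, polyDeriv_tmul, polyMul_tmul,
        polyMul_tmul, Polynomial.derivative_mul, TensorProduct.tmul_add]

/-- The formal derivative, as a derivation of the polynomial CDGA. -/
noncomputable def polyDer : Der (poly B) where
  map n := polyDeriv (B.cx.X n)
  map_d n x := polyDeriv_polyD B.cx n (n + 1) x
  map_mul h x y := polyDeriv_polyMul B h x y

/-- The integral of polynomials over the unit interval. -/
noncomputable def integral : ℚ[X] →ₗ[ℚ] ℚ :=
  Polynomial.lsum fun n => ((n + 1 : ℚ)⁻¹) • LinearMap.id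

/-- The fundamental theorem of calculus, checked on monomials. Characteristic zero enters here,
through the factors `1 / (n + 1)`. -/
lemma integral_derivative (p : ℚ[X]) :
    integral (Polynomial.derivative p) = p.eval 1 - p.eval 0 := by
  induction p using Polynomial.induction_on' with
  | add p q hp hq => simp only [map_add, hp, hq, Polynomial.eval_add]; ring
  | monomial n a =>
    rw [Polynomial.derivative_monomial, integral, Polynomial.lsum_apply,
      Polynomial.sum_monomial_index _ _ (by simp)]
    -- The constant monomial is split off because its derivative has the truncated exponent `0 - 1 =
    -- 0`.
    cases n with
    | zero => simp
    | succ n =>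
      have : (n + 1 : ℚ) ≠ 0 := by positivity
      simp
      field_simp

lemma contract_integral_polyDeriv (M : Type) [AddCommGroup M] [Module ℚ M] (x : M ⊗[ℚ] ℚ[X]) :
    contract M integral (polyDeriv M x) =
      contract M (Polynomial.leval 1) x - contract M (Polynomial.leval 0) x := by
  induction x using TensorProduct.induction_on with
  | zero => simp only [map_zero, sub_zero]
  | tmul x p =>
    rw [polyDeriv_tmul, contract_tmul, contract_tmul, contract_tmul, integral_derivative,
      Polynomial.leval_apply, Polynomial.leval_apply, sub_smul]
  | add x y hx hy =>
    simp only [map_add, hx, hy]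
    abel

end Polynomials

/-! ### The CDGA of forms `f + g dt` -/

section DifferentialForms

/-- The underlying graded module of a CDGA, with degrees raised by one. -/
def shift (T : CDGA) : ℕ → ModuleCat.{0} ℚ
  | 0 => ModuleCat.of ℚ PUnit
  | n + 1 => T.cx.X n

instance (T : CDGA) : Subsingleton (shift T 0) := inferInstanceAs (Subsingleton PUnit)

/-- Left multiplication on the shift. -/
def mulL (T : CDGA) : ∀ {i j k : ℕ}, i + j = k → (T.cx.X i →ₗ[ℚ] shift T j →ₗ[ℚ] shift T k)
  | _, 0, _, _ => 0
  | _, _ + 1, 0, _ => 0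
  | _, _ + 1, _ + 1, h => T.mul (Nat.succ.inj h)

/-- Right multiplication on the shift. -/
def mulR (T : CDGA) : ∀ {i j k : ℕ}, i + j = k → (shift T i →ₗ[ℚ] T.cx.X j →ₗ[ℚ] shift T k)
  | 0, _, _, _ => 0
  | _ + 1, _, 0, _ => 0
  | _ + 1, _, _ + 1, h => T.mul (Nat.succ.inj ((Nat.succ_add _ _).symm.trans h))

/-- The differential on the shift. -/
def shiftD (T : CDGA) : ∀ n : ℕ, shift T n →ₗ[ℚ] shift T (n + 1)
  | 0 => 0
  | n + 1 => (T.cx.d n (n + 1)).hom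

variable (T : CDGA)

/-- The identification of a CDGA with its shift. -/
def toShift (n : ℕ) : T.cx.X n →ₗ[ℚ] shift T (n + 1) := LinearMap.id

lemma mulL_one {j : ℕ} (g : shift T j) : mulL T (Nat.zero_add j) T.one g = g := by
  cases j with
  | zero => exact Subsingleton.elim _ _
  | succ j => exact T.one_mul (i := j) g

lemma mulR_one {j : ℕ} (g : shift T j) : mulR T (Nat.add_zero j) g T.one = g := by
  cases j with
  | zero => exact Subsingleton.elim _ _
  | succ j => exact T.mul_one (i := j) g

lemma mulR_zero_left {j k : ℕ} (h : 0 + j = k) (g : shift T 0) : mulR T h g = 0 := by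
  rw [Subsingleton.elim g 0, map_zero]

lemma mulL_zero_right {i k : ℕ} (h : i + 0 = k) (f : T.cx.X i) (g : shift T 0) :
    mulL T h f g = 0 := by
  rw [Subsingleton.elim g 0, map_zero]

variable {i j k ij jk l : ℕ} (hij : i + j = ij) (hjk : j + k = jk) (h₁ : ij + k = l)
  (h₂ : i + jk = l)

/-- The coefficient of `dt` in a form of degree `n` has degree `n - 1`, and is absent for `n = 0`.
The module laws here and below reduce to those of `T` after lowering degrees; where the shifted
factor has degree `0`, everything vanishes. -/
lemma mulL_mulL (x : T.cx.X i) (y : T.cx.X j) (z : shift T k) :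
    mulL T h₁ (T.mul hij x y) z = mulL T h₂ x (mulL T hjk y z) := by
  cases k with
  | zero => rw [mulL_zero_right, mulL_zero_right, map_zero]
  | succ k =>
    cases jk with
    | zero => omega
    | succ jk =>
      cases l with
      | zero => omega
      | succ l => exact T.mul_assoc hij (by omega) (by omega) (by omega) x y z

lemma mulR_mulL (x : T.cx.X i) (y : shift T j) (z : T.cx.X k) :
    mulR T h₁ (mulL T hij x y) z = mulL T h₂ x (mulR T hjk y z) := by
  cases j with
  | zero =>
    rw [mulL_zero_right, mulR_zero_left, map_zero, LinearMap.zero_apply, LinearMap.zero_apply,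
      map_zero]
  | succ j =>
    cases jk with
    | zero => omega
    | succ jk =>
      cases ij with
      | zero => omega
      | succ ij =>
        cases l with
        | zero => omega
        | succ l => exact T.mul_assoc (by omega) (by omega) (by omega) (by omega) x y z

lemma mulR_mulR (x : shift T i) (y : T.cx.X j) (z : T.cx.X k) :
    mulR T h₁ (mulR T hij x y) z = mulR T h₂ x (T.mul hjk y z) := by
  cases i with
  | zero =>
    rw [mulR_zero_left, mulR_zero_left, LinearMap.zero_apply, LinearMap.zero_apply, map_zero,
      LinearMap.zero_apply]
  | succ i =>
    cases ij with
    | zero => omega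
    | succ ij =>
      cases l with
      | zero => omega
      | succ l => exact T.mul_assoc (by omega) (by omega) (by omega) (by omega) x y z

/-- The element `y` has true degree `j - 1`, so the Koszul sign is `(-1)^(i(j-1))`, written without
subtraction. -/
lemma mulL_comm (h : i + j = k) (h' : j + i = k) (x : T.cx.X i) (y : shift T j) :
    mulL T h x y = ((-1 : ℚ) ^ (i * j) * (-1) ^ i) • mulR T h' y x := by
  cases j with
  | zero => rw [mulL_zero_right, mulR_zero_left, LinearMap.zero_apply, smul_zero]
  | succ j =>
    cases k with
    | zero => omega
    | succ k =>
      refine (T.mul_comm _ (by omega) x y).trans (congrArg (· • _) ?_)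
      rw [Nat.mul_succ, pow_add, _root_.mul_assoc, ← pow_add, ← two_mul, pow_mul]
      norm_num

lemma mulR_comm (h : i + j = k) (h' : j + i = k) (x : shift T i) (y : T.cx.X j) :
    (-1 : ℚ) ^ j • mulR T h x y = ((-1 : ℚ) ^ (i * j)) • mulL T h' y x := by
  rw [mulL_comm T h' h, smul_smul]
  congr 1
  rw [Nat.mul_comm j i, ← _root_.mul_assoc, ← pow_add, ← two_mul, pow_mul]
  norm_num

lemma shiftD_shiftD (n : ℕ) (x : shift T n) : shiftD T (n + 1) (shiftD T n x) = 0 := by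
  cases n with
  | zero => exact map_zero _
  | succ n => exact d_apply_d_apply T.cx (l := n) x

lemma shiftD_mulL (h : i + j = k) (h₁ : (i + 1) + j = k + 1) (h₂ : i + (j + 1) = k + 1)
    (x : T.cx.X i) (y : shift T j) :
    shiftD T k (mulL T h x y) =
      mulL T h₁ (T.cx.d i (i + 1) x) y + ((-1 : ℚ) ^ i) • mulL T h₂ x (shiftD T j y) := by
  cases j with
  | zero =>
    rw [mulL_zero_right, mulL_zero_right, Subsingleton.elim y 0]
    simp only [map_zero, smul_zero, add_zero]
  | succ j =>
    cases k with
    | zero => omega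
    | succ k => exact T.leibniz (by omega) (by omega) (by omega) x y

/-- The minus sign is the Leibniz sign `(-1)^(i-1)` for `x`, whose true degree is `i - 1`. -/
lemma shiftD_mulR (h : i + j = k) (h₁ : (i + 1) + j = k + 1) (h₂ : i + (j + 1) = k + 1)
    (x : shift T i) (y : T.cx.X j) :
    shiftD T k (mulR T h x y) =
      mulR T h₁ (shiftD T i x) y - ((-1 : ℚ) ^ i) • mulR T h₂ x (T.cx.d j (j + 1) y) := by
  cases i with
  | zero =>
    rw [mulR_zero_left, mulR_zero_left, Subsingleton.elim x 0]
    simp only [map_zero, LinearMap.zero_apply, smul_zero, sub_zero]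
  | succ i =>
    cases k with
    | zero => omega
    | succ k =>
      refine (T.leibniz _ (by omega) (by omega) x y).trans ?_
      rw [pow_succ, mul_neg_one, neg_smul, sub_neg_eq_add]
      rfl

variable {T} (D : Der T)

/-- The de Rham differential on forms `f + g dt`. -/
def formsD (n : ℕ) : (T.cx.X n × shift T n) →ₗ[ℚ] (T.cx.X (n + 1) × shift T (n + 1)) :=
  -- With `dt` written on the right, `dt · ∂f/∂t` becomes `(-1)^n (∂f/∂t) dt`, while `d (g dt) =
  -- (dg) dt` carries no sign.
  LinearMap.prod ((T.cx.d n (n + 1)).hom ∘ₗ LinearMap.fst ℚ _ _)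
    (((-1 : ℚ) ^ n • (toShift T n ∘ₗ D.map n)) ∘ₗ LinearMap.fst ℚ _ _ +
      shiftD T n ∘ₗ LinearMap.snd ℚ _ _)

lemma formsD_apply (n : ℕ) (x : T.cx.X n × shift T n) :
    formsD D n x = (T.cx.d n (n + 1) x.1,
      (-1 : ℚ) ^ n • toShift T n (D.map n x.1) + shiftD T n x.2) := rfl

/-- The two mixed terms agree because `∂/∂t` commutes with `d`, and their signs in degrees `n` and
`n + 1` are opposite. -/
lemma formsD_formsD (n : ℕ) (x : T.cx.X n × shift T n) :
    formsD D (n + 1) (formsD D n x) = 0 := by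
  rw [formsD_apply, formsD_apply]
  refine Prod.ext (d_apply_d_apply T.cx _) ?_
  have e : toShift T (n + 1) (T.cx.d n (n + 1) (D.map n x.1)) =
    shiftD T (n + 1) (toShift T n (D.map n x.1)) := rfl
  change (-1 : ℚ) ^ (n + 1) • toShift T (n + 1) (D.map (n + 1) (T.cx.d n (n + 1) x.1)) +
    shiftD T (n + 1) ((-1 : ℚ) ^ n • toShift T n (D.map n x.1) + shiftD T n x.2) = 0
  rw [map_add, shiftD_shiftD, add_zero, D.map_d, e, map_smul, pow_succ, mul_neg_one, neg_smul]
  exact neg_add_cancel _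

/-- The multiplication of forms `f + g dt`. -/
def formsMul {i j k : ℕ} (h : i + j = k) : (T.cx.X i × shift T i) →ₗ[ℚ]
    (T.cx.X j × shift T j) →ₗ[ℚ] (T.cx.X k × shift T k) :=
  LinearMap.mk₂ ℚ
    -- The sign `(-1)^j` comes from moving `dt` past `y.1`, and there is no further term since `dt ·
    -- dt = 0`.
    (fun x y => (T.mul h x.1 y.1, mulL T h x.1 y.2 + (-1 : ℚ) ^ j • mulR T h x.2 y.1))
    (fun x x' y => by
      simp only [Prod.fst_add, Prod.snd_add, map_add, LinearMap.add_apply, smul_add, Prod.mk_add_mk]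
      congr 1; abel)
    (fun c x y => by
      simp only [Prod.smul_fst, Prod.smul_snd, map_smul, LinearMap.smul_apply, smul_add,
        Prod.smul_mk, smul_comm c])
    (fun x y y' => by
      simp only [Prod.fst_add, Prod.snd_add, map_add, smul_add, Prod.mk_add_mk]
      congr 1; abel)
    (fun c x y => by
      simp only [Prod.smul_fst, Prod.smul_snd, map_smul, smul_add, Prod.smul_mk, smul_comm c])

lemma formsMul_apply {i j k : ℕ} (h : i + j = k) (x : T.cx.X i × shift T i)
    (y : T.cx.X j × shift T j) : formsMul h x y =
      (T.mul h x.1 y.1, mulL T h x.1 y.2 + (-1 : ℚ) ^ j • mulR T h x.2 y.1) := rfl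

lemma formsMul_assoc (x : T.cx.X i × shift T i) (y : T.cx.X j × shift T j)
    (z : T.cx.X k × shift T k) :
    formsMul h₁ (formsMul hij x y) z = formsMul h₂ x (formsMul hjk y z) := by
  simp only [formsMul_apply]
  refine Prod.ext (T.mul_assoc _ _ _ _ _ _ _) ?_
  simp only [map_add, LinearMap.add_apply, map_smul, LinearMap.smul_apply]
  rw [mulL_mulL T hij hjk h₁ h₂, mulR_mulL T hij hjk h₁ h₂, mulR_mulR T hij hjk h₁ h₂, smul_add,
    smul_smul, ← pow_add, Nat.add_comm k j, hjk, add_assoc]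

lemma formsMul_comm (h : i + j = k) (h' : j + i = k) (x : T.cx.X i × shift T i)
    (y : T.cx.X j × shift T j) : formsMul h x y = (-1 : ℚ) ^ (i * j) • formsMul h' y x := by
  simp only [formsMul_apply]
  refine Prod.ext (T.mul_comm h h' _ _) ?_
  simp only [Prod.smul_snd, smul_add]
  rw [mulL_comm T h h', mulR_comm T h h', smul_smul, add_comm]

lemma formsMul_one (x : T.cx.X i × shift T i) : formsMul (Nat.add_zero i) x (T.one, 0) = x := by
  rw [formsMul_apply]
  refine Prod.ext (T.mul_one _) ?_
  simp only [map_zero, zero_add, pow_zero, one_smul, mulR_one]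

lemma one_formsMul (x : T.cx.X i × shift T i) : formsMul (Nat.zero_add i) (T.one, 0) x = x := by
  rw [formsMul_apply]
  refine Prod.ext (T.one_mul _) ?_
  simp only [map_zero, LinearMap.zero_apply, smul_zero, add_zero, mulL_one]

/-- The `dt` component combines the Leibniz rules for `∂/∂t` and for the differential on both
one-sided products. Once `k` is `i + j`, only powers of `-1` remain to be compared. -/
lemma formsD_formsMul (h : i + j = k) (h₁ : (i + 1) + j = k + 1) (h₂ : i + (j + 1) = k + 1)
    (x : T.cx.X i × shift T i) (y : T.cx.X j × shift T j) :
    formsD D k (formsMul h x y) =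
      formsMul h₁ (formsD D i x) y + (-1 : ℚ) ^ i • formsMul h₂ x (formsD D j y) := by
  simp only [formsMul_apply, formsD_apply]
  refine Prod.ext (T.leibniz h h₁ h₂ _ _) ?_
  have e₁ : mulR T h₁ (toShift T i (D.map i x.1)) y.1 = toShift T k (T.mul h (D.map i x.1) y.1) :=
    rfl
  have e₂ : mulL T h₂ x.1 (toShift T j (D.map j y.1)) = toShift T k (T.mul h x.1 (D.map j y.1)) :=
    rfl
  simp only [Prod.snd_add, Prod.smul_snd, map_add, LinearMap.add_apply, map_smul,
    LinearMap.smul_apply]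
  rw [e₁, e₂, D.map_mul, map_add, shiftD_mulL T h h₁ h₂, shiftD_mulR T h h₁ h₂]
  obtain rfl := h
  simp only [pow_add, pow_one]
  module

/-- The complex of forms. -/
noncomputable def formsComplex : Ch :=
  CochainComplex.of (fun n => ModuleCat.of ℚ (T.cx.X n × shift T n))
    (fun n => ModuleCat.ofHom (formsD D n)) (fun n => by
      ext1
      exact LinearMap.ext fun x => formsD_formsD D n x)

lemma formsComplex_d_apply (n : ℕ) (x : T.cx.X n × shift T n) :
    (formsComplex D).d n (n + 1) x = formsD D n x := by
  have : (formsComplex D).d n (n + 1) = ModuleCat.ofHom (formsD D n) := by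
    simp only [formsComplex, CochainComplex.of_d]
  rw [this]
  rfl

/-- The CDGA of forms `f + g dt`, where `f` and `g` are elements of a CDGA equipped with a
derivation `∂/∂t`. -/
noncomputable def forms : CDGA where
  cx := formsComplex D
  one := ((T.one, 0) : T.cx.X 0 × shift T 0)
  mul h := formsMul (T := T) h
  one_mul x := one_formsMul x
  mul_one x := formsMul_one x
  mul_assoc hij hjk h₁ h₂ x y z := formsMul_assoc hij hjk h₁ h₂ x y z
  mul_comm h h' x y := formsMul_comm h h' x y
  leibniz {i j k} h h₁ h₂ x y := by
    refine (formsComplex_d_apply D k _).trans ((formsD_formsMul D h h₁ h₂ x y).trans ?_)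
    exact (congrArg₂ (fun a b => formsMul h₁ a y + (-1 : ℚ) ^ i • formsMul h₂ x b)
      (formsComplex_d_apply D i x) (formsComplex_d_apply D j y)).symm

/-- The restriction of forms to functions. -/
noncomputable def formsFst : forms D ⟶ T where
  hom :=
    { f := fun n => ModuleCat.ofHom (LinearMap.fst ℚ (T.cx.X n) (shift T n))
      comm' := by
        rintro m _ rfl
        ext1
        refine LinearMap.ext fun x => ?_
        exact (congrArg Prod.fst (formsComplex_d_apply D m x)).symm }
  map_one := rfl
  map_mul _ _ _ := rfl

/-- The map to forms induced by a map to constant functions. -/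
noncomputable def formsLift {A : CDGA} (f : A ⟶ T) (hf : ∀ n x, D.map n (f.hom.f n x) = 0) :
    A ⟶ forms D where
  hom :=
    { f := fun n => ModuleCat.ofHom (LinearMap.inl ℚ (T.cx.X n) (shift T n) ∘ₗ (f.hom.f n).hom)
      comm' := by
        rintro m _ rfl
        ext1
        refine LinearMap.ext fun x => ?_
        refine (formsComplex_d_apply D m (f.hom.f m x, 0)).trans ?_
        refine Prod.ext (hom_comm_apply f.hom _ _ _).symm ?_
        rw [formsD_apply]
        change (-1 : ℚ) ^ m • toShift T m (D.map m (f.hom.f m x)) + shiftD T m 0 = 0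
        rw [hf, map_zero, smul_zero, map_zero, add_zero] }
  map_one := Prod.ext f.map_one rfl
  map_mul {i j k} h x y := by
    refine Prod.ext (f.map_mul h x y) ?_
    change 0 = mulL T h (f.hom.f i x) 0 + (-1 : ℚ) ^ j • mulR T h 0 (f.hom.f j y)
    simp only [map_zero, LinearMap.zero_apply, smul_zero, add_zero]

end DifferentialForms

/-! ### The path object and integration over the interval -/

section PathObject

variable (B : CDGA)

/-- The CDGA of polynomial forms on the unit interval with coefficients in a CDGA. -/
noncomputable def path : CDGA := forms (polyDer B)

/-- The constant paths. -/
noncomputable def pathConst : B ⟶ path B :=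
  formsLift (polyDer B) (polyC B) fun n x => by
    refine (polyDeriv_tmul (M := B.cx.X n) x 1).trans ?_
    rw [Polynomial.derivative_one, TensorProduct.tmul_zero]
    rfl

/-- Evaluation of paths at a time. -/
noncomputable def pathEval (a : ℚ) : path B ⟶ B := formsFst (polyDer B) ≫ polyEval B a

lemma pathConst_pathEval (a : ℚ) : pathConst B ≫ pathEval B a = 𝟙 B := by
  ext n x
  refine (contract_tmul (Polynomial.leval a) x 1).trans ?_
  rw [Polynomial.leval_apply, Polynomial.eval_one, one_smul]
  rfl

/-- The endpoints of a path. -/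
noncomputable def pathEnds : path B ⟶ pi fun _ : Bool => B :=
  piLift fun b => pathEval B (if b then 1 else 0)

-- Interpolate linearly: `y₀ (1 - t) + y₁ t` has the prescribed endpoints.
open TensorProduct in
lemma pathEnds_surjective (n : ℕ) : Function.Surjective ((pathEnds B).hom.f n) := by
  intro y
  let p : B.cx.X n ⊗[ℚ] Polynomial ℚ :=
    (y : Bool → B.cx.X n) false ⊗ₜ (1 - Polynomial.X) + (y : Bool → B.cx.X n) true ⊗ₜ Polynomial.X
  refine ⟨((p, 0) : (poly B).cx.X n × shift (poly B) n), ?_⟩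
  funext b
  change contract (B.cx.X n) (Polynomial.leval _) p = _
  rw [map_add, contract_tmul, contract_tmul, Polynomial.leval_apply, Polynomial.leval_apply]
  cases b <;> simp

/-- Integration of a one-form over the unit interval. -/
noncomputable def shiftIntegral (n : ℕ) : shift (poly B) (n + 1) →ₗ[ℚ] B.cx.X n :=
  contract (B.cx.X n) integral

lemma d_shiftIntegral (n : ℕ) (g : shift (poly B) (n + 1)) :
    B.cx.d n (n + 1) (shiftIntegral B n g) = shiftIntegral B (n + 1) (shiftD (poly B) (n + 1) g) :=
  d_contract B.cx integral n (n + 1) g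

lemma shiftIntegral_toShift (n : ℕ) (f : (poly B).cx.X n) :
    shiftIntegral B n (toShift (poly B) n ((polyDer B).map n f)) =
      (polyEval B 1).hom.f n f - (polyEval B 0).hom.f n f :=
  contract_integral_polyDeriv (B.cx.X n) f

/-- For a closed form `f + g dt`, the `dt` component reads `(-1)^n f' + dg = 0`. Integrating over
`[0, 1]` gives `f(1) - f(0) = -(-1)^n d ∫ g`. -/
lemma isBdry_pathEval_sub {n : ℕ} (x : (path B).cx.X n) (hx : (path B).cx.d n (n + 1) x = 0) :
    IsBdry B.cx ((pathEval B 1).hom.f n x - (pathEval B 0).hom.f n x) := by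
  obtain ⟨f, g⟩ := (x : (poly B).cx.X n × shift (poly B) n)
  have h : (-1 : ℚ) ^ n • toShift (poly B) n ((polyDer B).map n f) + shiftD (poly B) n g = 0 :=
    congrArg Prod.snd ((formsComplex_d_apply (polyDer B) n (f, g)).symm.trans hx)
  have h' := congrArg (shiftIntegral B n) h
  rw [map_add, map_smul, shiftIntegral_toShift, map_zero] at h'
  have h₂ : (polyEval B 1).hom.f n f - (polyEval B 0).hom.f n f =
      -((-1 : ℚ) ^ n • shiftIntegral B n (shiftD (poly B) n g)) := by
    rw [eq_neg_of_add_eq_zero_right h', smul_neg, neg_neg, smul_smul, ← pow_add, ← two_mul,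
      pow_mul, neg_one_sq, one_pow, one_smul]
  change IsBdry B.cx ((polyEval B 1).hom.f n f - (polyEval B 0).hom.f n f)
  rw [h₂]
  -- In degree `0` there is no `dt` component, so `f` has equal endpoints.
  cases n with
  | zero =>
    rw [isBdry_zero_iff, shiftD, LinearMap.zero_apply, map_zero, smul_zero, neg_zero]
  | succ n =>
    refine ⟨n, -((-1 : ℚ) ^ (n + 1) • shiftIntegral B n g), ?_⟩
    rw [map_neg, map_smul, d_shiftIntegral]

end PathObject

end CDGA

/-! ### The acyclicity condition -/

section Acyclicity

open CDGA

/-- A morphism of CDGAs with the left lifting property against all surjections is a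
quasi-isomorphism: it has a retraction which is also a homotopy inverse. -/
lemma quasiIso_of_hasLiftingProperty {A B : CDGA} (i : A ⟶ B)
    (hi : ∀ {X Y : CDGA} (p : X ⟶ Y), (∀ n, Function.Surjective (p.hom.f n)) →
      HasLiftingProperty i p) : QuasiIso i.hom := by
  -- The empty product is the zero CDGA, so `A` maps onto it and the identity of `A` extends along
  -- `i`.
  obtain ⟨r, hr⟩ : ∃ r : B ⟶ A, i ≫ r = 𝟙 A := by
    have := hi (piLift (A := (PEmpty.elim : PEmpty → CDGA)) (B := A) (fun b => b.elim))
      (fun n y => ⟨0, funext fun b => b.elim⟩)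
    have sq : CommSq (𝟙 A) i (piLift (A := (PEmpty.elim : PEmpty → CDGA)) (B := A) (fun b => b.elim))
      (piLift (fun b => b.elim)) := ⟨pi_hom_ext fun b => b.elim⟩
    exact ⟨sq.lift, sq.fac_left⟩
  -- Since `𝟙 B` and `r ≫ i` agree after `i`, the constant path on `i` has the right endpoints, and
  -- lifting against the endpoint map yields a homotopy between them.
  obtain ⟨H, h₁, h₀⟩ : ∃ H : B ⟶ path B, H ≫ pathEval B 1 = 𝟙 B ∧
      H ≫ pathEval B 0 = r ≫ i := by
    have := hi (pathEnds B) (pathEnds_surjective B)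
    have sq : CommSq (i ≫ pathConst B) i (pathEnds B)
        (piLift fun b : Bool => if b then 𝟙 B else r ≫ i) := ⟨pi_hom_ext fun b => by
      rw [Category.assoc, Category.assoc, Category.assoc, piLift_proj, pathEnds, piLift_proj,
        pathConst_pathEval]
      cases b
      · change i ≫ 𝟙 B = i ≫ r ≫ i
        rw [reassoc_of% hr, Category.comp_id]
      · rfl⟩
    have e (b : Bool) : sq.lift ≫ pathEval B (if b then 1 else 0) =
        if b then 𝟙 B else r ≫ i := by
      have := congrArg (· ≫ piProj (fun _ : Bool => B) b) sq.fac_right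
      simpa only [Category.assoc, pathEnds, piLift_proj] using this
    exact ⟨sq.lift, e true, e false⟩
  have hr' (n : ℕ) (x : A.cx.X n) : r.hom.f n (i.hom.f n x) = x :=
    congrArg (fun φ : A ⟶ A => φ.hom.f n x) hr
  rw [quasiIso_iff_cocycles]
  refine fun n => ⟨fun x _ hb => ?_, fun y hy => ⟨r.hom.f n y, ?_, ?_⟩⟩
  · rw [← hr' n x]
    exact hb.map r.hom
  · rw [← hom_comm_apply, hy, map_zero]
  · have e₁ : (pathEval B 1).hom.f n (H.hom.f n y) = y :=
      congrArg (fun φ : B ⟶ B => φ.hom.f n y) h₁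
    have e₀ : (pathEval B 0).hom.f n (H.hom.f n y) = i.hom.f n (r.hom.f n y) :=
      congrArg (fun φ : B ⟶ B => φ.hom.f n y) h₀
    rw [← e₀]
    nth_rw 1 [← e₁]
    exact isBdry_pathEval_sub B _ (by rw [← hom_comm_apply, hy, map_zero])

/-- The right Kan extension of a CDGA along the inclusion of a point. -/
def coind (r : ℝ≥0) (A : CDGA) : PCDGA where
  -- A product over the proofs of `s ≤ r`: it is `A` up to time `r` and the zero CDGA afterwards,
  -- with no case distinction.
  obj s := pi fun _ : PLift (s ≤ r) => A
  map f := piLift fun h => piProj (fun _ => A) ⟨(leOfHom f).trans h.down⟩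

/-- The right Kan extension along the inclusion of a point, on morphisms. -/
def coindMap (r : ℝ≥0) {A B : CDGA} (g : A ⟶ B) : coind r A ⟶ coind r B where
  app s := piLift fun h => piProj (fun _ => A) h ≫ g

/-- The map to the right Kan extension determined by its value at a point. -/
def coindLift {r : ℝ≥0} {X : PCDGA} {A : CDGA} (g : X.obj r ⟶ A) : X ⟶ coind r A where
  app s := piLift fun h => X.map (homOfLE h.down) ≫ g
  naturality s t f := pi_hom_ext fun h => by
    change X.map f ≫ X.map (homOfLE h.down) ≫ g = X.map _ ≫ g
    rw [← X.map_comp_assoc]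
    rfl

/-- For `t ≤ r` the structure maps from `s` to `t` are identities, so `x` itself serves as the lift.
For `t > r` everything at time `t` is zero, and surjectivity of `g` suffices. -/
lemma isFib_coindMap (r : ℝ≥0) {A B : CDGA} (g : A ⟶ B)
    (hg : ∀ n, Function.Surjective (g.hom.f n)) : IsFib (pForget.map (coindMap r g)) where
  surj s n y := by
    choose x hx using fun h : PLift (s ≤ r) => hg n ((y : PLift (s ≤ r) → B.cx.X n) h)
    exact ⟨x, funext hx⟩
  lift {s t} hst n y x hxy := by
    by_cases ht : t ≤ r
    · refine ⟨fun _ => (x : PLift (t ≤ r) → A.cx.X n) ⟨ht⟩, ?_, ?_⟩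
      · funext h
        exact congrFun hxy (⟨ht⟩ : PLift (t ≤ r))
      · funext h
        rfl
    · choose x' hx' using fun h : PLift (s ≤ r) => hg n ((y : PLift (s ≤ r) → B.cx.X n) h)
      exact ⟨x', funext hx', funext fun h => absurd h.down ht⟩

lemma setΛJ_rlp_coindMap (r : ℝ≥0) {A B : CDGA} (g : A ⟶ B)
    (hg : ∀ n, Function.Surjective (g.hom.f n)) : setΛJ.rlp (coindMap r g) :=
  (setΛJ_rlp_iff _).2 (setJ_rlp_iff.2 (isFib_coindMap r g hg))

/-- Evaluation at `r` is left adjoint to `coind r`, so a lifting problem for `j.app r` against `g`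
transposes to one for `j` against the fibration `coindMap r g`. -/
lemma hasLiftingProperty_app {M N : PCDGA} (j : M ⟶ N) (hj : setΛJ.rlp.llp j) (r : ℝ≥0)
    {A B : CDGA} (g : A ⟶ B) (hg : ∀ n, Function.Surjective (g.hom.f n)) :
    HasLiftingProperty (j.app r) g where
  sq_hasLift {u v} sq := by
    have := hj _ (setΛJ_rlp_coindMap r g hg)
    have sq' : CommSq (coindLift u) j (coindMap r g) (coindLift v) := ⟨by
      ext1
      ext1 s
      refine pi_hom_ext fun h => ?_
      change (M.map (homOfLE h.down) ≫ u) ≫ g = j.app s ≫ N.map (homOfLE h.down) ≫ v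
      rw [Category.assoc, sq.w, j.naturality_assoc]⟩
    let p (C : CDGA) : (coind r C).obj r ⟶ C := piProj (fun _ => C) ⟨le_rfl⟩
    refine ⟨⟨⟨sq'.lift.app r ≫ p A, ?_, ?_⟩⟩⟩
    · rw [← Category.assoc, ← NatTrans.comp_app, sq'.fac_left]
      change M.map (𝟙 r) ≫ u = u
      rw [M.map_id, Category.id_comp]
    · have e := congrArg (fun φ => NatTrans.app φ r ≫ p B) sq'.fac_right
      refine Eq.trans ?_ (e.trans ?_)
      · rfl
      · change N.map (𝟙 r) ≫ v = v
        rw [N.map_id, Category.id_comp]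

/-- The maps with the left lifting property against fibrations are weak equivalences. -/
lemma setΛJ_rlp_llp_le : setΛJ.rlp.llp ≤ pointwiseQuasiIso.inverseImage pForget :=
  fun _ _ j hj r => quasiIso_of_hasLiftingProperty (j.app r)
    (fun g hg => hasLiftingProperty_app j hj r g hg)

end Acyclicity

/-! ### The recognition theorem -/

section Recognition

universe v u

open MorphismProperty

variable {C : Type u} [Category.{v} C] (W I J : MorphismProperty C)

lemma isWeakFactorizationSystem_of_hasSmallObjectArgument [HasSmallObjectArgument.{v} I] :
    IsWeakFactorizationSystem I.rlp.llp I.rlp where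
  rlp := rlp_llp_rlp I
  llp := rfl

variable {W I J}

/-- The retract argument: factor `i` by the small object argument for `J`. By two-out-of-three the
second factor lies in `W`, hence in `I.rlp`, so `i` lifts against it and is a retract of the first
factor. -/
lemma llp_inf_eq (hI : I.rlp = J.rlp ⊓ W) (hJ : J.rlp.llp ≤ W) [W.HasTwoOutOfThreeProperty]
    [HasSmallObjectArgument.{v} J] : I.rlp.llp ⊓ W = J.rlp.llp := by
  apply le_antisymm
  · rintro X Y i ⟨hi, hw⟩
    let h := factorizationData J.rlp.llp J.rlp i
    have hp : I.rlp h.p := by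
      rw [hI]
      refine ⟨h.hp, W.of_precomp h.i h.p (hJ _ h.hi) ?_⟩
      rwa [h.fac]
    have := hi _ hp
    exact of_retract (RetractArrow.ofLeftLiftingProperty h.fac) h.hi
  · exact le_inf (antitone_llp (by rw [hI]; exact inf_le_left)) hJ

/-- The recognition theorem for combinatorial model structures. -/
lemma exists_modelCategory [IsLocallyPresentable.{v} C] [HasLimitsOfSize.{v, v} C]
    [HasColimitsOfSize.{v, v} C] [W.HasTwoOutOfThreeProperty] [HasSmallObjectArgument.{v} I]
    [HasSmallObjectArgument.{v} J] (hI : I.rlp = J.rlp ⊓ W) (hJ : J.rlp.llp ≤ W) :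
    ∃ _ : ModelCategory C, weakEquivalences C = W ∧ fibrations C = J.rlp ∧
      IsCombinatorialModelStructure I J := by
  have htc' := llp_inf_eq hI hJ
  let : CategoryWithFibrations C := ⟨J.rlp⟩
  let : CategoryWithCofibrations C := ⟨I.rlp.llp⟩
  let : CategoryWithWeakEquivalences C := ⟨W⟩
  have hw : weakEquivalences C = W := rfl
  have hc : cofibrations C = I.rlp.llp := rfl
  have hf : fibrations C = J.rlp := rfl
  have htf : trivialFibrations C = I.rlp := hI.symm
  have htc : trivialCofibrations C = J.rlp.llp := htc'
  have : (weakEquivalences C).HasTwoOutOfThreeProperty := by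
    rw [hw]
    infer_instance
  have : IsWeakFactorizationSystem (cofibrations C) (trivialFibrations C) := by
    rw [hc, htf]
    exact isWeakFactorizationSystem_of_hasSmallObjectArgument I
  have : IsWeakFactorizationSystem (trivialCofibrations C) (fibrations C) := by
    rw [hf, htc]
    exact isWeakFactorizationSystem_of_hasSmallObjectArgument J
  have : HasFiniteLimits C := hasFiniteLimits_of_hasLimitsOfSize.{v, v} C
  have : HasFiniteColimits C := hasFiniteColimits_of_hasColimitsOfSize.{v, v} C
  have h₁ : HasFunctorialFactorization (cofibrations C) (trivialFibrations C) := by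
    rw [hc, htf]
    infer_instance
  have h₂ : HasFunctorialFactorization (trivialCofibrations C) (fibrations C) := by
    rw [hf, htc]
    infer_instance
  let m : ModelCategory C := ModelCategory.mk' C
  exact ⟨m, hw, hf, ⟨inferInstance, inferInstance, inferInstance, inferInstance, inferInstance,
    htf, hf, hc, htc, h₁, h₂⟩⟩

end Recognition

/-! ### The hypotheses of the recognition theorem for persistent CDGAs -/

instance : (pointwiseQuasiIso.inverseImage pForget).HasTwoOutOfThreeProperty where
  comp_mem f g hf hg r := by
    have : QuasiIso (f.app r).hom := hf r
    have : QuasiIso (g.app r).hom := hg r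
    exact quasiIso_comp (f.app r).hom (g.app r).hom
  of_postcomp f g hg hfg r := by
    have : QuasiIso (g.app r).hom := hg r
    have : QuasiIso ((f.app r).hom ≫ (g.app r).hom) := hfg r
    exact quasiIso_of_comp_right (f.app r).hom (g.app r).hom
  of_precomp f g hf hfg r := by
    have : QuasiIso (f.app r).hom := hf r
    have : QuasiIso ((f.app r).hom ≫ (g.app r).hom) := hfg r
    exact quasiIso_of_comp_left (f.app r).hom (g.app r).hom

lemma setΛJ_rlp_eq : setΛJ.rlp = setJ.rlp.inverseImage pForget := by
  ext _ _ f
  exact setΛJ_rlp_iff f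

lemma setΛI_rlp_eq : setΛI.rlp = setΛJ.rlp ⊓ pointwiseQuasiIso.inverseImage pForget := by
  ext _ _ f
  rw [setΛI_rlp_iff, setI_rlp_iff_setJ_rlp, setΛJ_rlp_eq]
  rfl

end PersistentCDGA

theorem mainTheorem6 :
    ∃ _ : ModelCategory PersistentCDGA.PCDGA,
      weakEquivalences PersistentCDGA.PCDGA =
        PersistentCDGA.pointwiseQuasiIso.inverseImage PersistentCDGA.pForget ∧
      fibrations PersistentCDGA.PCDGA =
        PersistentCDGA.setJ.rlp.inverseImage PersistentCDGA.pForget ∧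
      PersistentCDGA.IsCombinatorialModelStructure
        PersistentCDGA.setΛI PersistentCDGA.setΛJ := by
  rw [← PersistentCDGA.setΛJ_rlp_eq]
  exact PersistentCDGA.exists_modelCategory PersistentCDGA.setΛI_rlp_eq
    PersistentCDGA.setΛJ_rlp_llp_le
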